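/- Let $d\ge1$, $\mathbb{T}^d=(\mathbb{R}/2\pi\mathbb{Z})^d$, $\gamma>d/2$ and $T>0$. For $s\ge 0$ let $\|f\|_{H^s}=(2\pi)^{d/2}\big(\sum_{\xi\in\mathbb{Z}^d}(1+|\xi|^2)^{s}|\hat f(\xi)|^2\big)^{1/2}$ with $\hat f(\xi)=(2\pi)^{-d}\int_{\mathbb{T}^d}e^{-ix\cdot\xi}f(x)\,dx$, and for a function $F$ let $F(\Delta)$ be the operator that multiplies $\hat f(\xi)$ by $F(-|\xi|^2)$. Put $$\varphi(z)=\frac{e^z-1}{z}\ (z\ne0),\quad \varphi(0)=1,\qquad \psi(z)=\frac{e^z-1-ze^z}{z^2}\ (z\neq0),\quad \psi(0)=-\tfrac12 .$$ Let $u_0\in H^{\gamma+2}(\mathbb{T}^d)$ and let $u\in L^\infty(0,T;H^{\gamma+2}(\mathbb{T}^d))$ be a solution on $[0,T]$ of the cubic nonlinear Schrödinger equation $$i\partial_tu+\Delta u+|u|^2u=0,\qquad u(0)=u_0 ,$$ that is, $u\in C([0,T];L^2(\mathbb{T}^d))$, $u(0)=u_0$, and for every $\xi\in\mathbb{Z}^d$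 and $t\in(0,T)$ the function $\hat u(\cdot,\xi)$ is differentiable at $t$ with $i\partial_t\hat u(t,\xi)-|\xi|^2\hat u(t,\xi)+\widehat{|u|^2u}(t,\xi)=0$. For a step size $\tau>0$ define $u^0=u_0$ and, for $n\ge0$, $$u^{n+1}=e^{i\tau\Delta}u^n+i\tau e^{i\tau\Delta}\Big\{\big(\big[\varphi(-2i\tau\Delta)+\psi(-2i\tau\Delta)\big]\overline{u^n}\big)\cdot(u^n)^2\Big\}-i\tau\big[e^{i\tau\Delta}\psi(-2i\tau\Delta)\overline{u^n}\big]\cdot\big(e^{i\tau\Delta}u^n\big)^2-\frac{\tau^2}{2}e^{i\tau\Delta}\Big[|u^n|^4u^n\Big].$$ Then there are constants $\tau_0,C>0$ such that $$\|u(n\tau)-u^n\|_{H^\gamma}\le C\tau^2\qquad\text{for all } 0<\tau\le\tau_0 \text{ and all integers } n\ge0 \text{ with } n\tau\le T .$$ For fixed $d$ and $\gamma$, the constants $\tau_0$ and $C$ depend only on $T$ and $\|u\|_{L^\infty(0,T;H^{\gamma+2})}$; more precisely, for every $M\ge0$ they can be chosen to be the same for all $u_0$ and $u$ as above with $\|u\|_{L^\infty(0,T;H^{\gamma+2})}\le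 M$. -/

import Mathlib

open MeasureTheory
open scoped ENNReal NNReal ComplexConjugate

noncomputable section

namespace CubicNLS

/-- The period `2π` is positive, so that `ℝ / 2πℤ` carries its Lebesgue measure of mass `2π`. -/
instance two_pi_pos_fact : Fact ((0 : ℝ) < 2 * Real.pi) := ⟨Real.two_pi_pos⟩

/-- The torus `𝕋^d = (ℝ / 2πℤ)^d`; `volume` is the product Lebesgue measure, of mass `(2π)^d`. -/
abbrev Torus (d : ℕ) : Type := Fin d → AddCircle (2 * Real.pi)

/-- The complex Hilbert space `L²(𝕋^d)`. -/
abbrev L2 (d : ℕ) : Type := Lp ℂ 2 (volume : Measure (Torus d))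

/-- The Fourier mode `x ↦ e^{i x·ξ}`, for `ξ ∈ ℤ^d`. -/
def mode {d : ℕ} (ξ : Fin d → ℤ) (x : Torus d) : ℂ := ∏ j, fourier (ξ j) (x j)

/-- The Fourier coefficient `(2π)^{-d} ∫ e^{-i x·ξ} f(x) dx`. -/
def coeff {d : ℕ} (f : Torus d → ℂ) (ξ : Fin d → ℤ) : ℂ :=
  ((2 * Real.pi : ℝ) : ℂ)⁻¹ ^ d * ∫ x, conj (mode ξ x) * f x

/-- `|ξ|² = ξ·ξ`. -/
def freqSq {d : ℕ} (ξ : Fin d → ℤ) : ℝ := ∑ j, (ξ j : ℝ) ^ 2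

/-- The norm `(2π)^{d/2} (∑_ξ (1 + |ξ|²)^s |f̂(ξ)|²)^{1/2}` of `H^s(𝕋^d)`, with value `∞` when `f`
does not belong to `H^s(𝕋^d)`. -/
def sobolevNorm {d : ℕ} (s : ℝ) (f : L2 d) : ℝ≥0∞ :=
  ENNReal.ofReal ((2 * Real.pi) ^ ((d : ℝ) / 2)) *
    (∑' ξ : Fin d → ℤ, ENNReal.ofReal ((1 + freqSq ξ) ^ s * ‖coeff f ξ‖ ^ 2)) ^ ((1 : ℝ) / 2)

/-- The Sobolev space `H^s(𝕋^d)`, `s ≥ 0`, as a subset of `L²(𝕋^d)`. -/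
def sobolev (d : ℕ) (s : ℝ) : Set (L2 d) := {f | sobolevNorm s f < ∞}

open Classical in
/-- The operator `F(Δ)` on `L²(𝕋^d)`: it multiplies the Fourier coefficient at `ξ` by `F(-|ξ|²)`.
The element of `L²` with the new coefficients is unique, and it exists for every `f` in the domain
of `F(Δ)`, hence for every `f` when `F` is bounded on `(-∞, 0]`. (The value is `0` off the
domain.) -/
def funLaplacian {d : ℕ} (F : ℂ → ℂ) (f : L2 d) : L2 d :=
  if h : ∃ g : L2 d, ∀ ξ, coeff g ξ = F (-(freqSq ξ : ℂ)) * coeff f ξ then h.choose else 0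

open Classical in
/-- A square-integrable function, as an element of `L²(𝕋^d)` (and `0` for all other functions). -/
def toL2 {d : ℕ} (f : Torus d → ℂ) : L2 d :=
  if h : MemLp f 2 (volume : Measure (Torus d)) then h.toLp f else 0

/-- `φ(z) = (e^z - 1) / z`, `φ(0) = 1`. -/
def phi (z : ℂ) : ℂ := if z = 0 then 1 else (Complex.exp z - 1) / z

/-- `ψ(z) = (e^z - 1 - z e^z) / z²`, `ψ(0) = -1/2`. -/
def psi (z : ℂ) : ℂ := if z = 0 then -1 / 2 else (Complex.exp z - 1 - z * Complex.exp z) / z ^ 2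

/-- The free Schrödinger propagator `e^{iτΔ}`. -/
def propagator {d : ℕ} (τ : ℝ) : L2 d → L2 d := funLaplacian fun z => Complex.exp (Complex.I * τ * z)

/-- The operator `φ(-2iτΔ)`. -/
def phiOp {d : ℕ} (τ : ℝ) : L2 d → L2 d := funLaplacian fun z => phi (-2 * Complex.I * τ * z)

/-- The operator `ψ(-2iτΔ)`. -/
def psiOp {d : ℕ} (τ : ℝ) : L2 d → L2 d := funLaplacian fun z => psi (-2 * Complex.I * τ * z)

/-- The complex conjugate `x ↦ conj (f x)`. -/
def conjL2 {d : ℕ} (f : L2 d) : L2 d := toL2 fun x => conj (f x)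

/-- One step of size `τ` of the scheme:
`e^{iτΔ}w + iτ e^{iτΔ}{([φ(-2iτΔ) + ψ(-2iτΔ)] w̄) w²} - iτ (e^{iτΔ} ψ(-2iτΔ) w̄) (e^{iτΔ}w)²
  - (τ²/2) e^{iτΔ}(|w|⁴ w)`. -/
def lriStep {d : ℕ} (τ : ℝ) (w : L2 d) : L2 d :=
  propagator τ w
    + (Complex.I * τ) •
        propagator τ (toL2 fun x => (phiOp τ (conjL2 w) + psiOp τ (conjL2 w)) x * w x ^ 2)
    - (Complex.I * τ) •
        toL2 (fun x => propagator τ (psiOp τ (conjL2 w)) x * propagator τ w x ^ 2)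
    - ((τ : ℂ) ^ 2 / 2) • propagator τ (toL2 fun x => (‖w x‖ : ℂ) ^ 4 * w x)

/-- The numerical solution `u^n` with step size `τ` and `u^0 = u₀`. -/
def lri {d : ℕ} (τ : ℝ) (u₀ : L2 d) : ℕ → L2 d
  | 0 => u₀
  | n + 1 => lriStep τ (lri τ u₀ n)

/-- `u` is a solution on `[0, T]` of `i ∂ₜu + Δu + |u|²u = 0`, `u(0) = u₀`: it is continuous in time
with values in `L²`, takes the initial value, and satisfies the equation weakly in space, i.e.
after it has been tested against each `e^{i x·ξ}`. (As the test functions are the Fourier modes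
only, every stronger notion of solution implies this one.) -/
structure IsSolution {d : ℕ} (T : ℝ) (u₀ : L2 d) (u : ℝ → L2 d) : Prop where
  continuousOn : ContinuousOn u (Set.Icc 0 T)
  initial : u 0 = u₀
  equation : ∀ t ∈ Set.Ioo 0 T, ∀ ξ : Fin d → ℤ, ∃ v : ℂ,
    HasDerivAt (fun s => coeff (u s) ξ) v t ∧
      Complex.I * v + (-(freqSq ξ : ℂ)) * coeff (u t) ξ
        + coeff (fun x => (‖u t x‖ : ℂ) ^ 2 * u t x) ξ = 0

/-- The norm of `L^∞((0, T); H^s(𝕋^d))`. -/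
def supSobolevNorm {d : ℕ} (s T : ℝ) (u : ℝ → L2 d) : ℝ≥0∞ :=
  essSup (fun t => sobolevNorm s (u t)) (volume.restrict (Set.Ioo 0 T))

end CubicNLS

end

/-! In the interaction picture v(s) = e^{-isΔ}u(t+s), the derivative of v is i times a trilinear sum
over frequencies ξ (of the conjugated factor), η, ζ with unimodular symbol e^{isα}. Here α = 2|ξ|² +
β and β = |ξ+η+ζ|² - |ξ|² - |η|² - |ζ|² = 2(ξ·η + ξ·ζ + η·ζ). The scheme keeps e^{2is|ξ|²} exactly
and replaces e^{isβ} by its linear interpolant in s between 0 and τ. As β has no pure squares, β² ≤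
12(1+|ξ|²)(1+|η|²)(1+|ζ|²) (`sq_beta_le`), so the O(τ²β²) error costs two derivatives on each
factor: this is why H^{γ+2} suffices.

Integrating the approximate symbol over [0, τ] produces φ, ψ and e^{iτβ}. The last splits into
phases of single frequencies, so it is realised by propagators around a pointwise product
(`tri_primSym_self`, `coeff_lriStep`). The variation of v during the step is, to first order, is
times the coefficients of |v|²v. Put into the nonlinearity, it contributes is|v|⁴v, whose integral
is the quintic correction. What remains in the derivative is O(τ²) in H^γ (`seqNorm_defect_le`), and
the mean value inequality gives a local error O(τ³) (`seqNorm_localError_le`).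

For γ > d/2, H^γ embeds into the sequences with summable coefficients and is an algebra, so
trilinear operators with bounded symbols are bounded on it (`exists_seqNorm_tri_le`). Hence one step
has Lipschitz constant 1 + Lτ on balls (`seqNorm_stepSeq_sub_le`). An induction sums the local
errors to O(τ²), and for small τ the error stays below 1, which keeps the numerical solution in a
fixed ball (`seqNorm_error_le`). -/

noncomputable section

namespace CubicNLS

/-! ### Weighted `ℓ²` norms of sequences -/

section L2Seq

variable {ι : Type*}

/-- The `ℓ²` norm of a nonnegative sequence. -/
def l2 (f : ι → ℝ≥0∞) : ℝ≥0∞ := (∑' i, f i ^ 2) ^ ((1 : ℝ) / 2)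

lemma l2_sq (f : ι → ℝ≥0∞) : l2 f ^ 2 = ∑' i, f i ^ 2 := by
  rw [l2, ← ENNReal.rpow_natCast, ← ENNReal.rpow_mul]; norm_num

lemma le_of_sq_le_sq {a b : ℝ≥0∞} (h : a ^ 2 ≤ b ^ 2) : a ≤ b :=
  (ENNReal.pow_le_pow_left_iff (by norm_num)).mp h

lemma l2_mono {f g : ι → ℝ≥0∞} (h : ∀ i, f i ≤ g i) : l2 f ≤ l2 g := by
  apply le_of_sq_le_sq
  rw [l2_sq, l2_sq]
  exact ENNReal.tsum_le_tsum fun i => pow_le_pow_left' (h i) 2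

lemma l2_const_mul (c : ℝ≥0∞) (f : ι → ℝ≥0∞) : l2 (fun i => c * f i) = c * l2 f := by
  have : l2 (fun i => c * f i) ^ 2 = (c * l2 f) ^ 2 := by
    rw [mul_pow, l2_sq, l2_sq, ← ENNReal.tsum_mul_left]
    simp only [mul_pow]
  exact le_antisymm (le_of_sq_le_sq this.le) (le_of_sq_le_sq this.ge)

lemma l2_comp_equiv {κ : Type*} (e : κ ≃ ι) (f : ι → ℝ≥0∞) : l2 (fun i => f (e i)) = l2 f := by
  rw [l2, l2, e.tsum_eq (fun i => f i ^ 2)]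

lemma tsum_mul_le_l2_mul_l2 (f g : ι → ℝ≥0∞) : ∑' i, f i * g i ≤ l2 f * l2 g := by
  let _ : MeasurableSpace ι := ⊤
  have := ENNReal.lintegral_mul_le_Lp_mul_Lq (Measure.count : Measure ι)
    Real.HolderConjugate.two_two (f := f) (g := g) (by fun_prop) (by fun_prop)
  simpa [lintegral_count, l2] using this

lemma l2_add_le (f g : ι → ℝ≥0∞) : l2 (fun i => f i + g i) ≤ l2 f + l2 g := by
  let _ : MeasurableSpace ι := ⊤
  have := ENNReal.lintegral_Lp_add_le (μ := (Measure.count : Measure ι)) (f := f) (g := g)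
    (by fun_prop) (by fun_prop) (p := 2) (by norm_num)
  simpa [lintegral_count, l2] using this

/-- Cauchy–Schwarz with respect to the measure of density `g`, obtained by writing g = √g·√g. It is
the pointwise half of Young's inequality. -/
lemma tsum_mul_sq_le (f g : ι → ℝ≥0∞) :
    (∑' i, f i * g i) ^ 2 ≤ (∑' i, g i) * ∑' i, g i * f i ^ 2 := by
  have hs (x : ℝ≥0∞) : (x ^ ((1 : ℝ) / 2)) ^ 2 = x := by
    rw [← ENNReal.rpow_natCast, ← ENNReal.rpow_mul]; norm_num
  have h := tsum_mul_le_l2_mul_l2 (fun i => g i ^ ((1 : ℝ) / 2)) fun i => g i ^ ((1 : ℝ) / 2) * f i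
  have h' : ∀ i, g i ^ ((1 : ℝ) / 2) * (g i ^ ((1 : ℝ) / 2) * f i) = f i * g i := fun i => by
    rw [← mul_assoc, ← sq, hs, mul_comm]
  simp only [h'] at h
  refine (pow_le_pow_left' h 2).trans_eq ?_
  rw [mul_pow, l2_sq, l2_sq]
  simp only [mul_pow, hs]

end L2Seq

/-! ### Convolutions of nonnegative sequences -/

section Convolution

variable {G : Type*} [AddCommGroup G]

/-- The convolution of nonnegative sequences. -/
def conv (f g : G → ℝ≥0∞) (ξ : G) : ℝ≥0∞ := ∑' η, f η * g (ξ - η)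

lemma conv_comm (f g : G → ℝ≥0∞) : conv f g = conv g f := by
  ext ξ
  rw [conv, conv, ← (Equiv.subLeft ξ).tsum_eq]
  simp [mul_comm]

lemma tsum_conv (f g : G → ℝ≥0∞) : ∑' ξ, conv f g ξ = (∑' ξ, f ξ) * ∑' ξ, g ξ := by
  simp only [conv]
  rw [ENNReal.tsum_comm, ← ENNReal.tsum_mul_right]
  refine tsum_congr fun η => ?_
  rw [ENNReal.tsum_mul_left]
  exact congrArg _ ((Equiv.subRight η).tsum_eq g)

/-- Young's inequality `ℓ¹ * ℓ² ⊆ ℓ²`. -/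
lemma l2_conv_le (f g : G → ℝ≥0∞) : l2 (conv f g) ≤ (∑' ξ, f ξ) * l2 g := by
  apply le_of_sq_le_sq
  rw [mul_pow, l2_sq, l2_sq]
  calc ∑' ξ, conv f g ξ ^ 2
      ≤ ∑' ξ, (∑' η, f η) * conv f (fun i => g i ^ 2) ξ := by
        refine ENNReal.tsum_le_tsum fun ξ => ?_
        have := tsum_mul_sq_le (fun η => g (ξ - η)) f
        simpa only [conv, mul_comm] using this
    _ = _ := by rw [ENNReal.tsum_mul_left, tsum_conv]; ring

end Convolution

/-! ### The Japanese bracket -/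

section Bracket

variable {d : ℕ}

lemma freqSq_nonneg (ξ : Fin d → ℤ) : 0 ≤ freqSq ξ := Finset.sum_nonneg fun _ _ => sq_nonneg _

lemma freqSq_neg (ξ : Fin d → ℤ) : freqSq (-ξ) = freqSq ξ := by simp [freqSq]

lemma freqSq_add_le (ξ η : Fin d → ℤ) : freqSq (ξ + η) ≤ 2 * freqSq ξ + 2 * freqSq η := by
  simp only [freqSq, Finset.mul_sum, ← Finset.sum_add_distrib]
  refine Finset.sum_le_sum fun j _ => ?_
  push_cast [Pi.add_apply]
  nlinarith [sq_nonneg ((ξ j : ℝ) - η j)]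

lemma one_le_one_add_freqSq (ξ : Fin d → ℤ) : 1 ≤ 1 + freqSq ξ := by
  linarith [freqSq_nonneg ξ]

lemma one_add_freqSq_pos (ξ : Fin d → ℤ) : 0 < 1 + freqSq ξ := by linarith [freqSq_nonneg ξ]

/-- The weight `(1 + |ξ|²)^{s/2}`. -/
def wt (s : ℝ) (ξ : Fin d → ℤ) : ℝ≥0∞ := ENNReal.ofReal ((1 + freqSq ξ) ^ (s / 2))

lemma wt_neg (s : ℝ) (ξ : Fin d → ℤ) : wt s (-ξ) = wt s ξ := by rw [wt, wt, freqSq_neg]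

lemma wt_ne_top (s : ℝ) (ξ : Fin d → ℤ) : wt s ξ ≠ ∞ := ENNReal.ofReal_ne_top

lemma wt_add_exponent (s t : ℝ) (ξ : Fin d → ℤ) : wt (s + t) ξ = wt s ξ * wt t ξ := by
  have := one_add_freqSq_pos ξ
  rw [wt, wt, wt, ← ENNReal.ofReal_mul (by positivity), ← Real.rpow_add this, add_div]

lemma wt_zero (ξ : Fin d → ℤ) : wt 0 ξ = 1 := by simp [wt]

lemma wt_two (ξ : Fin d → ℤ) : wt 2 ξ = ENNReal.ofReal (1 + freqSq ξ) := by simp [wt]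

lemma wt_mono {s t : ℝ} (h : s ≤ t) (ξ : Fin d → ℤ) : wt s ξ ≤ wt t ξ :=
  ENNReal.ofReal_le_ofReal
    (Real.rpow_le_rpow_of_exponent_le (one_le_one_add_freqSq ξ) (by linarith))

/-- The bracket 1 + |ξ+η|² is at most four times the larger of the two brackets, and a maximum of
powers is at most their sum. -/
lemma wt_add_le {s : ℝ} (hs : 0 ≤ s) (ξ η : Fin d → ℤ) :
    wt s (ξ + η) ≤ ENNReal.ofReal (4 ^ (s / 2)) * (wt s ξ + wt s η) := by
  have h1 := one_add_freqSq_pos ξ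
  have h2 := one_add_freqSq_pos η
  have h3 := one_add_freqSq_pos (ξ + η)
  rw [wt, wt, wt, ← ENNReal.ofReal_add (by positivity) (by positivity),
    ← ENNReal.ofReal_mul (by positivity)]
  refine ENNReal.ofReal_le_ofReal ?_
  have hle : 1 + freqSq (ξ + η) ≤ 4 * max (1 + freqSq ξ) (1 + freqSq η) := by
    have := freqSq_add_le ξ η
    have := le_max_left (1 + freqSq ξ) (1 + freqSq η)
    have := le_max_right (1 + freqSq ξ) (1 + freqSq η)
    linarith
  calc (1 + freqSq (ξ + η)) ^ (s / 2)
      ≤ (4 * max (1 + freqSq ξ) (1 + freqSq η)) ^ (s / 2) := by gcongr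
    _ = 4 ^ (s / 2) * max (1 + freqSq ξ) (1 + freqSq η) ^ (s / 2) := by
        rw [Real.mul_rpow (by norm_num) (by positivity)]
    _ ≤ _ := by
        gcongr
        rcases max_cases (1 + freqSq ξ) (1 + freqSq η) with h | h <;> rw [h.1]
        · linarith [show 0 ≤ (1 + freqSq η) ^ (s / 2) by positivity]
        · linarith [show 0 ≤ (1 + freqSq ξ) ^ (s / 2) by positivity]

lemma norm_sq_le_freqSq (ξ : Fin d → ℤ) : ‖(fun j => (ξ j : ℝ))‖ ^ 2 ≤ freqSq ξ := by
  have : ‖(fun j => (ξ j : ℝ))‖ ≤ √(freqSq ξ) := by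
    refine (pi_norm_le_iff_of_nonneg (Real.sqrt_nonneg _)).2 fun j => ?_
    refine Real.le_sqrt_of_sq_le ?_
    rw [Real.norm_eq_abs, sq_abs]
    exact Finset.single_le_sum (f := fun j => (ξ j : ℝ) ^ 2) (fun _ _ => sq_nonneg _)
      (Finset.mem_univ j)
  calc _ ≤ √(freqSq ξ) ^ 2 := by gcongr
    _ = _ := Real.sq_sqrt (freqSq_nonneg ξ)

/-- Comparison with the lattice sum of ‖x‖^{-2γ} over ℤ^d ⊂ ℝ^d, which converges because 2γ > d. -/
lemma summable_one_add_freqSq_rpow {γ : ℝ} (hγ : (d : ℝ) / 2 < γ) :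
    Summable fun ξ : Fin d → ℤ => (1 + freqSq ξ) ^ (-γ) := by
  have hγ0 : 0 < γ := lt_of_le_of_lt (by positivity) hγ
  let b := Pi.basisFun ℝ (Fin d)
  let L : Submodule ℤ (Fin d → ℝ) := Submodule.span ℤ (Set.range b)
  have hmem (ξ : Fin d → ℤ) : (fun j => (ξ j : ℝ)) ∈ L := by
    rw [b.mem_span_iff_repr_mem ℤ]
    intro i
    exact ⟨ξ i, by simp [b]⟩
  have hfin : Module.finrank ℤ L = d := by
    rw [ZLattice.rank ℝ L]; simp
  have hs := ZLattice.summable_norm_rpow L (-2 * γ) (by rw [hfin]; linarith)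
  have hinj : Function.Injective fun ξ : Fin d → ℤ => (⟨fun j => (ξ j : ℝ), hmem ξ⟩ : L) := by
    intro ξ η h
    funext j
    have : (ξ j : ℝ) = η j := congrFun (congrArg Subtype.val h) j
    exact_mod_cast this
  refine Summable.of_norm_bounded_eventually (hs.comp_injective hinj) ?_
  -- The origin has to be left out: there the comparison term is `0 ^ (-2 * γ) = 0`, while the
  -- weight is 1.
  have : ({0}ᶜ : Set (Fin d → ℤ)) ∈ Filter.cofinite := (Set.finite_singleton 0).compl_mem_cofinite
  filter_upwards [this] with ξ hξ
  have h0 : 0 < ‖(fun j => (ξ j : ℝ))‖ := by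
    rw [norm_pos_iff]
    intro h
    apply hξ
    funext j
    have : (ξ j : ℝ) = 0 := congrFun h j
    exact_mod_cast this
  have h1 := one_add_freqSq_pos ξ
  rw [Real.norm_of_nonneg (by positivity)]
  change _ ≤ ‖(fun j => (ξ j : ℝ))‖ ^ (-2 * γ)
  rw [show -2 * γ = 2 * (-γ) by ring, Real.rpow_mul h0.le]
  refine Real.rpow_le_rpow_of_nonpos (by positivity) ?_ (by linarith)
  have := norm_sq_le_freqSq ξ
  norm_cast
  linarith

lemma l2_wt_neg_lt_top {γ : ℝ} (hγ : (d : ℝ) / 2 < γ) :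
    l2 (fun ξ : Fin d → ℤ => wt (-γ) ξ) < ∞ := by
  refine ENNReal.rpow_lt_top_of_nonneg (by norm_num) ?_
  have h (ξ : Fin d → ℤ) : wt (-γ) ξ ^ 2 = ENNReal.ofReal ((1 + freqSq ξ) ^ (-γ)) := by
    rw [sq, ← wt_add_exponent, wt]; ring_nf
  simp only [h]
  exact (summable_one_add_freqSq_rpow hγ).tsum_ofReal_ne_top

end Bracket

/-! ### Sobolev norms of coefficient sequences and the algebra property -/

variable {d : ℕ}

/-- The Sobolev norm `(∑ (1 + |ξ|²)^s |a ξ|²)^{1/2}` of a sequence of Fourier coefficients. -/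
def seqNorm (s : ℝ) (a : (Fin d → ℤ) → ℂ) : ℝ≥0∞ := l2 fun ξ => wt s ξ * ‖a ξ‖ₑ

lemma seqNorm_mono {s : ℝ} {a b : (Fin d → ℤ) → ℂ} (h : ∀ ξ, ‖a ξ‖ₑ ≤ ‖b ξ‖ₑ) :
    seqNorm s a ≤ seqNorm s b := l2_mono fun ξ => by gcongr; exact h ξ

lemma seqNorm_congr {s : ℝ} {a b : (Fin d → ℤ) → ℂ} (h : ∀ ξ, ‖a ξ‖ₑ = ‖b ξ‖ₑ) :
    seqNorm s a = seqNorm s b :=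
  le_antisymm (seqNorm_mono fun ξ => (h ξ).le) (seqNorm_mono fun ξ => (h ξ).ge)

lemma seqNorm_mono_exponent {s t : ℝ} (h : s ≤ t) (a : (Fin d → ℤ) → ℂ) :
    seqNorm s a ≤ seqNorm t a := l2_mono fun ξ => by gcongr; exact wt_mono h ξ

lemma seqNorm_add_le (s : ℝ) (a b : (Fin d → ℤ) → ℂ) :
    seqNorm s (a + b) ≤ seqNorm s a + seqNorm s b := by
  refine (l2_mono fun ξ => ?_).trans (l2_add_le _ _)
  rw [← mul_add]
  gcongr
  exact enorm_add_le _ _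

lemma seqNorm_smul (s : ℝ) (c : ℂ) (a : (Fin d → ℤ) → ℂ) :
    seqNorm s (c • a) = ‖c‖ₑ * seqNorm s a := by
  rw [seqNorm, seqNorm, ← l2_const_mul]
  congr 1; ext ξ
  rw [Pi.smul_apply, enorm_smul]; ring

lemma seqNorm_neg (s : ℝ) (a : (Fin d → ℤ) → ℂ) : seqNorm s (-a) = seqNorm s a :=
  seqNorm_congr fun ξ => by simp

lemma seqNorm_sub_le (s : ℝ) (a b : (Fin d → ℤ) → ℂ) :
    seqNorm s (a - b) ≤ seqNorm s a + seqNorm s b := by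
  rw [sub_eq_add_neg, ← seqNorm_neg s b]; exact seqNorm_add_le s a (-b)

lemma seqNorm_zero (s : ℝ) : seqNorm s (0 : (Fin d → ℤ) → ℂ) = 0 := by
  simp [seqNorm, l2]

/-- The Fourier coefficients of the complex conjugate. -/
def cstar (a : (Fin d → ℤ) → ℂ) (ξ : Fin d → ℤ) : ℂ := conj (a (-ξ))

lemma seqNorm_cstar (s : ℝ) (a : (Fin d → ℤ) → ℂ) : seqNorm s (cstar a) = seqNorm s a := by
  rw [seqNorm, seqNorm, ← l2_comp_equiv (Equiv.neg (Fin d → ℤ))]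
  congr 1; ext ξ
  simp [cstar, wt_neg, enorm_eq_nnnorm]

lemma cstar_sub (a b : (Fin d → ℤ) → ℂ) : cstar (a - b) = cstar a - cstar b := by
  ext ξ; simp [cstar]

/-- Cauchy–Schwarz after multiplying and dividing by the weight. For γ > d/2 the first factor is
finite, and this is the embedding of H^γ into the Wiener algebra. -/
lemma tsum_le_l2_wt (γ : ℝ) (f : (Fin d → ℤ) → ℝ≥0∞) :
    ∑' ξ, f ξ ≤ l2 (fun ξ : Fin d → ℤ => wt (-γ) ξ) * l2 fun ξ => wt γ ξ * f ξ := by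
  have h (ξ : Fin d → ℤ) : wt (-γ) ξ * (wt γ ξ * f ξ) = f ξ := by
    rw [← mul_assoc, ← wt_add_exponent, neg_add_cancel, wt_zero, one_mul]
  simpa only [h] using tsum_mul_le_l2_mul_l2 (fun ξ => wt (-γ) ξ) fun ξ => wt γ ξ * f ξ

lemma tsum_enorm_le (γ : ℝ) (a : (Fin d → ℤ) → ℂ) :
    ∑' ξ, ‖a ξ‖ₑ ≤ l2 (fun ξ : Fin d → ℤ => wt (-γ) ξ) * seqNorm γ a :=
  tsum_le_l2_wt γ fun ξ => ‖a ξ‖ₑ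

lemma summable_of_tsum_enorm_ne_top {ι : Type*} {a : ι → ℂ} (h : ∑' i, ‖a i‖ₑ ≠ ∞) :
    Summable fun i => ‖a i‖ := by
  have := ENNReal.summable_toReal h
  simpa using this

lemma summable_of_seqNorm_lt_top {γ : ℝ} (hγ : (d : ℝ) / 2 < γ) {a : (Fin d → ℤ) → ℂ}
    (h : seqNorm γ a < ∞) : Summable fun ξ => ‖a ξ‖ :=
  summable_of_tsum_enorm_ne_top
    ((tsum_enorm_le γ a).trans_lt (ENNReal.mul_lt_top (l2_wt_neg_lt_top hγ) h)).ne

/-- The algebra property of `H^γ`, `γ > d/2`, for weighted convolutions of absolute values. -/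
lemma exists_l2_wt_conv_le {γ : ℝ} (hγ : (d : ℝ) / 2 < γ) :
    ∃ K : ℝ≥0, ∀ f g : (Fin d → ℤ) → ℝ≥0∞,
      l2 (fun ξ => wt γ ξ * conv f g ξ)
        ≤ K * l2 (fun ξ => wt γ ξ * f ξ) * l2 (fun ξ => wt γ ξ * g ξ) := by
  have hγ0 : 0 ≤ γ := le_trans (by positivity) hγ.le
  set c := ENNReal.ofReal (4 ^ (γ / 2))
  set S := l2 (fun ξ : Fin d → ℤ => wt (-γ) ξ)
  have hKfin : c * (2 * S) ≠ ∞ :=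
    ENNReal.mul_ne_top ENNReal.ofReal_ne_top
      (ENNReal.mul_ne_top (by norm_num) (l2_wt_neg_lt_top hγ).ne)
  refine ⟨(c * (2 * S)).toNNReal, fun f g => ?_⟩
  rw [ENNReal.coe_toNNReal hKfin]
  -- The weight at ξ is moved onto one of the two factors. The other factor is then measured in ℓ¹
  -- by Young's inequality, and ℓ¹ is controlled by H^γ.
  have hpt (ξ : Fin d → ℤ) : wt γ ξ * conv f g ξ
      ≤ c * (conv g (fun η => wt γ η * f η) ξ + conv f (fun η => wt γ η * g η) ξ) := by
    rw [conv_comm g]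
    simp only [conv, ← ENNReal.tsum_mul_left, ← ENNReal.tsum_add]
    refine ENNReal.tsum_le_tsum fun η => ?_
    calc wt γ ξ * (f η * g (ξ - η))
        ≤ c * (wt γ η + wt γ (ξ - η)) * (f η * g (ξ - η)) := by
          gcongr
          simpa using wt_add_le hγ0 η (ξ - η)
      _ = _ := by ring
  calc l2 (fun ξ => wt γ ξ * conv f g ξ)
      ≤ c * l2 (fun ξ => conv g (fun η => wt γ η * f η) ξ + conv f (fun η => wt γ η * g η) ξ) := by
        rw [← l2_const_mul]; exact l2_mono hpt
    _ ≤ c * ((∑' ξ, g ξ) * l2 (fun η => wt γ η * f η)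
          + (∑' ξ, f ξ) * l2 (fun η => wt γ η * g η)) := by
        gcongr
        refine (l2_add_le _ _).trans ?_
        gcongr <;> exact l2_conv_le _ _
    _ ≤ c * ((S * l2 (fun η => wt γ η * g η)) * l2 (fun η => wt γ η * f η)
          + (S * l2 (fun η => wt γ η * f η)) * l2 (fun η => wt γ η * g η)) := by
        gcongr <;> exact tsum_le_l2_wt γ _
    _ = _ := by ring

/-! ### Trilinear Fourier multipliers -/

/-- The trilinear operator with Fourier symbol `m`. -/
def tri (m : (Fin d → ℤ) → (Fin d → ℤ) → (Fin d → ℤ) → ℂ) (a b c : (Fin d → ℤ) → ℂ)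
    (ξ : Fin d → ℤ) : ℂ :=
  ∑' p : (Fin d → ℤ) × (Fin d → ℤ),
    m p.1 p.2 (ξ - p.1 - p.2) * (a p.1 * b p.2 * c (ξ - p.1 - p.2))

lemma tsum_prod_eq_conv (f g h : (Fin d → ℤ) → ℝ≥0∞) (ξ : Fin d → ℤ) :
    ∑' p : (Fin d → ℤ) × (Fin d → ℤ), f p.1 * g p.2 * h (ξ - p.1 - p.2)
      = conv f (conv g h) ξ := by
  rw [ENNReal.tsum_prod']
  refine tsum_congr fun η => ?_
  simp only [conv, ← ENNReal.tsum_mul_left, mul_assoc]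

lemma tsum_enorm_tri_le {m : (Fin d → ℤ) → (Fin d → ℤ) → (Fin d → ℤ) → ℂ} {B : ℝ≥0∞}
    (hm : ∀ ξ η ζ, ‖m ξ η ζ‖ₑ ≤ B) (a b c : (Fin d → ℤ) → ℂ) (ξ : Fin d → ℤ) :
    ∑' p : (Fin d → ℤ) × (Fin d → ℤ),
        ‖m p.1 p.2 (ξ - p.1 - p.2) * (a p.1 * b p.2 * c (ξ - p.1 - p.2))‖ₑ
      ≤ B * conv (fun η => ‖a η‖ₑ) (conv (fun η => ‖b η‖ₑ) fun η => ‖c η‖ₑ) ξ := by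
  rw [← tsum_prod_eq_conv, ← ENNReal.tsum_mul_left]
  refine ENNReal.tsum_le_tsum fun p => ?_
  simp only [enorm_mul]
  gcongr
  exact hm _ _ _

/-- Trilinear operators with bounded symbols are bounded on `H^γ`, `γ > d/2`. -/
lemma exists_seqNorm_tri_le {γ : ℝ} (hγ : (d : ℝ) / 2 < γ) :
    ∃ K : ℝ≥0, ∀ (m : (Fin d → ℤ) → (Fin d → ℤ) → (Fin d → ℤ) → ℂ) (B : ℝ≥0∞),
      (∀ ξ η ζ, ‖m ξ η ζ‖ₑ ≤ B) → ∀ a b c : (Fin d → ℤ) → ℂ,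
        seqNorm γ (tri m a b c) ≤ K * B * (seqNorm γ a * seqNorm γ b * seqNorm γ c) := by
  obtain ⟨K, hK⟩ := exists_l2_wt_conv_le hγ
  refine ⟨K * K, fun m B hm a b c => ?_⟩
  calc seqNorm γ (tri m a b c)
      ≤ l2 (fun ξ => B * (wt γ ξ *
          conv (fun η => ‖a η‖ₑ) (conv (fun η => ‖b η‖ₑ) fun η => ‖c η‖ₑ) ξ)) := by
        refine l2_mono fun ξ => ?_
        rw [mul_left_comm]
        gcongr
        exact enorm_tsum_le_tsum_enorm.trans (tsum_enorm_tri_le hm a b c ξ)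
    _ ≤ B * (K * seqNorm γ a * (K * seqNorm γ b * seqNorm γ c)) := by
        rw [l2_const_mul]
        gcongr
        refine (hK _ _).trans ?_
        gcongr
        · exact le_rfl
        · exact hK _ _
    _ = _ := by push_cast; ring

/-- Trilinear operators whose symbol grows by two derivatives in each variable. -/
lemma exists_seqNorm_tri_le_of_growth {γ : ℝ} (hγ : (d : ℝ) / 2 < γ) :
    ∃ K : ℝ≥0, ∀ (m : (Fin d → ℤ) → (Fin d → ℤ) → (Fin d → ℤ) → ℂ) (B : ℝ≥0∞),
      (∀ ξ η ζ, ‖m ξ η ζ‖ₑ ≤ B * (wt 2 ξ * wt 2 η * wt 2 ζ)) → ∀ a b c : (Fin d → ℤ) → ℂ,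
        seqNorm γ (tri m a b c)
          ≤ K * B * (seqNorm (γ + 2) a * seqNorm (γ + 2) b * seqNorm (γ + 2) c) := by
  obtain ⟨K, hK⟩ := exists_l2_wt_conv_le hγ
  refine ⟨K * K, fun m B hm a b c => ?_⟩
  -- The growth of the symbol is absorbed into the sequences, so that the algebra property is only
  -- needed at the level γ.
  have hw (a : (Fin d → ℤ) → ℂ) :
      seqNorm (γ + 2) a = l2 fun ξ => wt γ ξ * (wt 2 ξ * ‖a ξ‖ₑ) := by
    simp only [seqNorm, wt_add_exponent, mul_assoc]
  calc seqNorm γ (tri m a b c)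
      ≤ l2 (fun ξ => B * (wt γ ξ * conv (fun η => wt 2 η * ‖a η‖ₑ)
          (conv (fun η => wt 2 η * ‖b η‖ₑ) fun η => wt 2 η * ‖c η‖ₑ) ξ)) := by
        refine l2_mono fun ξ => ?_
        rw [mul_left_comm]
        gcongr
        refine enorm_tsum_le_tsum_enorm.trans ?_
        rw [← tsum_prod_eq_conv, ← ENNReal.tsum_mul_left]
        refine ENNReal.tsum_le_tsum fun p => ?_
        simp only [enorm_mul]
        calc _ ≤ B * (wt 2 p.1 * wt 2 p.2 * wt 2 (ξ - p.1 - p.2)) *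
              (‖a p.1‖ₑ * ‖b p.2‖ₑ * ‖c (ξ - p.1 - p.2)‖ₑ) := by gcongr; exact hm _ _ _
          _ = _ := by ring
    _ ≤ B * (K * seqNorm (γ + 2) a * (K * seqNorm (γ + 2) b * seqNorm (γ + 2) c)) := by
        rw [l2_const_mul, hw, hw, hw]
        gcongr
        refine (hK _ _).trans ?_
        gcongr
        exact hK _ _
    _ = _ := by push_cast; ring

/-! ### Absolute convergence and multilinearity of trilinear operators -/

section Summability

lemma tsum_ne_top_of_summable_norm {ι : Type*} {a : ι → ℂ} (h : Summable fun i => ‖a i‖) :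
    ∑' i, ‖a i‖ₑ ≠ ∞ := by
  have := h.tsum_ofReal_ne_top
  simpa only [ofReal_norm] using this

lemma tsum_conv_conv (a b c : (Fin d → ℤ) → ℂ) :
    ∑' ξ, conv (fun η => ‖a η‖ₑ) (conv (fun η => ‖b η‖ₑ) fun η => ‖c η‖ₑ) ξ
      = (∑' ξ, ‖a ξ‖ₑ) * ((∑' ξ, ‖b ξ‖ₑ) * ∑' ξ, ‖c ξ‖ₑ) := by
  rw [tsum_conv, tsum_conv]

variable {m : (Fin d → ℤ) → (Fin d → ℤ) → (Fin d → ℤ) → ℂ} {B : ℝ≥0∞} {a b c : (Fin d → ℤ) → ℂ}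

/-- The double sum is at most `B` times the product of the three ℓ¹ norms. Since `tsum` is 0 on
non-summable families, additivity of `tri` in its arguments and in its symbol relies on this
absolute convergence. -/
lemma tsum_tsum_enorm_tri_ne_top (hm : ∀ ξ η ζ, ‖m ξ η ζ‖ₑ ≤ B) (hB : B ≠ ∞)
    (ha : Summable fun ξ => ‖a ξ‖) (hb : Summable fun ξ => ‖b ξ‖)
    (hc : Summable fun ξ => ‖c ξ‖) :
    ∑' ξ, ∑' p : (Fin d → ℤ) × (Fin d → ℤ),
        ‖m p.1 p.2 (ξ - p.1 - p.2) * (a p.1 * b p.2 * c (ξ - p.1 - p.2))‖ₑ ≠ ∞ := by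
  refine ne_top_of_le_ne_top ?_ (ENNReal.tsum_le_tsum fun ξ => tsum_enorm_tri_le hm a b c ξ)
  rw [ENNReal.tsum_mul_left, tsum_conv_conv]
  have := tsum_ne_top_of_summable_norm ha
  have := tsum_ne_top_of_summable_norm hb
  have := tsum_ne_top_of_summable_norm hc
  finiteness

lemma summable_tri_norm (hm : ∀ ξ η ζ, ‖m ξ η ζ‖ₑ ≤ B) (hB : B ≠ ∞)
    (ha : Summable fun ξ => ‖a ξ‖) (hb : Summable fun ξ => ‖b ξ‖)
    (hc : Summable fun ξ => ‖c ξ‖) (ξ : Fin d → ℤ) :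
    Summable fun p : (Fin d → ℤ) × (Fin d → ℤ) =>
      ‖m p.1 p.2 (ξ - p.1 - p.2) * (a p.1 * b p.2 * c (ξ - p.1 - p.2))‖ :=
  summable_of_tsum_enorm_ne_top
    (ENNReal.ne_top_of_tsum_ne_top (tsum_tsum_enorm_tri_ne_top hm hB ha hb hc) ξ)

lemma summable_norm_tri (hm : ∀ ξ η ζ, ‖m ξ η ζ‖ₑ ≤ B) (hB : B ≠ ∞)
    (ha : Summable fun ξ => ‖a ξ‖) (hb : Summable fun ξ => ‖b ξ‖)
    (hc : Summable fun ξ => ‖c ξ‖) : Summable fun ξ => ‖tri m a b c ξ‖ :=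
  summable_of_tsum_enorm_ne_top <| ne_top_of_le_ne_top
    (tsum_tsum_enorm_tri_ne_top hm hB ha hb hc)
    (ENNReal.tsum_le_tsum fun _ => enorm_tsum_le_tsum_enorm)

lemma tri_sub_left (hm : ∀ ξ η ζ, ‖m ξ η ζ‖ₑ ≤ B) (hB : B ≠ ∞) {a' : (Fin d → ℤ) → ℂ}
    (ha : Summable fun ξ => ‖a ξ‖) (ha' : Summable fun ξ => ‖a' ξ‖)
    (hb : Summable fun ξ => ‖b ξ‖) (hc : Summable fun ξ => ‖c ξ‖) :
    tri m (a - a') b c = tri m a b c - tri m a' b c := by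
  ext ξ
  rw [Pi.sub_apply, tri, tri, tri, ← (summable_tri_norm hm hB ha hb hc ξ).of_norm.tsum_sub
    (summable_tri_norm hm hB ha' hb hc ξ).of_norm]
  refine tsum_congr fun p => ?_
  rw [Pi.sub_apply]; ring

lemma tri_sub_mid (hm : ∀ ξ η ζ, ‖m ξ η ζ‖ₑ ≤ B) (hB : B ≠ ∞) {b' : (Fin d → ℤ) → ℂ}
    (ha : Summable fun ξ => ‖a ξ‖) (hb : Summable fun ξ => ‖b ξ‖)
    (hb' : Summable fun ξ => ‖b' ξ‖) (hc : Summable fun ξ => ‖c ξ‖) :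
    tri m a (b - b') c = tri m a b c - tri m a b' c := by
  ext ξ
  rw [Pi.sub_apply, tri, tri, tri, ← (summable_tri_norm hm hB ha hb hc ξ).of_norm.tsum_sub
    (summable_tri_norm hm hB ha hb' hc ξ).of_norm]
  refine tsum_congr fun p => ?_
  rw [Pi.sub_apply]; ring

lemma tri_sub_right (hm : ∀ ξ η ζ, ‖m ξ η ζ‖ₑ ≤ B) (hB : B ≠ ∞) {c' : (Fin d → ℤ) → ℂ}
    (ha : Summable fun ξ => ‖a ξ‖) (hb : Summable fun ξ => ‖b ξ‖)
    (hc : Summable fun ξ => ‖c ξ‖) (hc' : Summable fun ξ => ‖c' ξ‖) :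
    tri m a b (c - c') = tri m a b c - tri m a b c' := by
  ext ξ
  rw [Pi.sub_apply, tri, tri, tri, ← (summable_tri_norm hm hB ha hb hc ξ).of_norm.tsum_sub
    (summable_tri_norm hm hB ha hb hc' ξ).of_norm]
  refine tsum_congr fun p => ?_
  rw [Pi.sub_apply]; ring

lemma tri_sub_symbol {m' : (Fin d → ℤ) → (Fin d → ℤ) → (Fin d → ℤ) → ℂ}
    (hm : ∀ ξ η ζ, ‖m ξ η ζ‖ₑ ≤ B) (hm' : ∀ ξ η ζ, ‖m' ξ η ζ‖ₑ ≤ B) (hB : B ≠ ∞)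
    (ha : Summable fun ξ => ‖a ξ‖) (hb : Summable fun ξ => ‖b ξ‖)
    (hc : Summable fun ξ => ‖c ξ‖) :
    tri (fun ξ η ζ => m ξ η ζ - m' ξ η ζ) a b c = tri m a b c - tri m' a b c := by
  ext ξ
  rw [Pi.sub_apply, tri, tri, tri, ← (summable_tri_norm hm hB ha hb hc ξ).of_norm.tsum_sub
    (summable_tri_norm hm' hB ha hb hc ξ).of_norm]
  refine tsum_congr fun p => ?_
  ring

lemma tri_smul_left (k : ℂ) : tri m (k • a) b c = k • tri m a b c := by
  ext ξ
  simp only [tri, Pi.smul_apply, smul_eq_mul, ← tsum_mul_left]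
  refine tsum_congr fun p => ?_
  ring

lemma tri_smul_mid (k : ℂ) : tri m a (k • b) c = k • tri m a b c := by
  ext ξ
  simp only [tri, Pi.smul_apply, smul_eq_mul, ← tsum_mul_left]
  refine tsum_congr fun p => ?_
  ring

lemma tri_smul_right (k : ℂ) : tri m a b (k • c) = k • tri m a b c := by
  ext ξ
  simp only [tri, Pi.smul_apply, smul_eq_mul, ← tsum_mul_left]
  refine tsum_congr fun p => ?_
  ring

end Summability

/-! ### Fourier series on the torus -/

lemma mode_add (ξ η : Fin d → ℤ) (x : Torus d) : mode (ξ + η) x = mode ξ x * mode η x := by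
  simp only [mode, Pi.add_apply, fourier_add, ← Finset.prod_mul_distrib]

lemma mode_neg (ξ : Fin d → ℤ) (x : Torus d) : mode (-ξ) x = conj (mode ξ x) := by
  simp only [mode, Pi.neg_apply, fourier_neg, map_prod]

lemma mode_zero (x : Torus d) : mode (0 : Fin d → ℤ) x = 1 := by
  simp [mode]

lemma norm_mode (ξ : Fin d → ℤ) (x : Torus d) : ‖mode ξ x‖ = 1 := by
  simp only [mode, fourier_apply, norm_prod, Circle.norm_coe, Finset.prod_const_one]

/-- The Fourier mode as a continuous function. -/
def modeC (ξ : Fin d → ℤ) : C(Torus d, ℂ) where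
  toFun := mode ξ
  continuous_toFun := by unfold mode; fun_prop

lemma modeC_apply (ξ : Fin d → ℤ) (x : Torus d) : modeC ξ x = mode ξ x := rfl

lemma norm_modeC_le (ξ : Fin d → ℤ) : ‖modeC ξ‖ ≤ 1 :=
  (ContinuousMap.norm_le _ zero_le_one).mpr fun x => (norm_mode ξ x).le

lemma mode_single (x : Torus d) (i : Fin d) : mode (Pi.single i 1) x = fourier 1 (x i) := by
  rw [mode, Finset.prod_eq_single i]
  · simp
  · intro j _ hj
    simp [Pi.single_eq_of_ne hj]
  · simp

/-! ### Completeness of the Fourier modes, by Stone–Weierstrass -/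

/-- The star algebra of trigonometric polynomials. -/
def trigAlgebra (d : ℕ) : StarSubalgebra ℂ C(Torus d, ℂ) where
  toSubalgebra := Algebra.adjoin ℂ (Set.range modeC)
  star_mem' := by
    change Algebra.adjoin ℂ (Set.range modeC) ≤ star (Algebra.adjoin ℂ (Set.range modeC))
    refine Algebra.adjoin_le ?_
    rintro _ ⟨ξ, rfl⟩
    refine Algebra.subset_adjoin ⟨-ξ, ?_⟩
    ext1 x
    simp only [modeC_apply, mode_neg, starRingEnd_apply, ContinuousMap.star_apply]

/-- Products of modes are modes, so their linear span is already closed under multiplication. -/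
lemma trigAlgebra_eq_span :
    Subalgebra.toSubmodule (trigAlgebra d).toSubalgebra = Submodule.span ℂ (Set.range modeC) := by
  apply Algebra.adjoin_eq_span_of_subset
  refine .trans (fun x => Submonoid.closure_induction (fun _ => id) ⟨0, ?_⟩ ?_)
    Submodule.subset_span
  · ext x
    simp [modeC_apply, mode_zero]
  · rintro _ _ _ _ ⟨ξ, rfl⟩ ⟨η, rfl⟩
    refine ⟨ξ + η, ?_⟩
    ext x
    simp [modeC_apply, mode_add]

/-- The mode of a unit frequency vector depends injectively on the corresponding coordinate of the
point. -/
lemma trigAlgebra_separatesPoints : (trigAlgebra d).SeparatesPoints := by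
  intro x y hxy
  rw [Ne, funext_iff, not_forall] at hxy
  obtain ⟨i, hi⟩ := hxy
  refine ⟨_, ⟨modeC (Pi.single i 1), Algebra.subset_adjoin ⟨Pi.single i 1, rfl⟩, rfl⟩, ?_⟩
  change mode _ x ≠ mode _ y
  rw [mode_single, mode_single, fourier_one, fourier_one]
  contrapose! hi
  exact AddCircle.injective_toCircle Real.two_pi_pos.ne' (Circle.ext hi)

lemma span_modeC_closure :
    (Submodule.span ℂ (Set.range (modeC (d := d)))).topologicalClosure = ⊤ := by
  rw [← trigAlgebra_eq_span]
  exact congr_arg (Subalgebra.toSubmodule <| StarSubalgebra.toSubalgebra ·)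
    (ContinuousMap.starSubalgebra_topologicalClosure_eq_top_of_separatesPoints _
      trigAlgebra_separatesPoints)

/-- The Fourier mode as an element of `L²`. -/
def modeLp (ξ : Fin d → ℤ) : L2 d := ContinuousMap.toLp (E := ℂ) 2 volume ℂ (modeC ξ)

lemma coeFn_modeLp (ξ : Fin d → ℤ) : modeLp ξ =ᵐ[volume] mode ξ :=
  ContinuousMap.coeFn_toLp volume (modeC ξ)

lemma span_modeLp_closure :
    (Submodule.span ℂ (Set.range (modeLp (d := d)))).topologicalClosure = ⊤ := by
  have := (ContinuousMap.toLp_denseRange (p := 2) ℂ (volume : Measure (Torus d)) ℂ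
    (by norm_num)).topologicalClosure_map_submodule (span_modeC_closure (d := d))
  simpa only [Submodule.map_span, ContinuousLinearMap.coe_coe, ← Set.range_comp,
    Function.comp_def] using! this

lemma integral_fourier_eq_ite (n : ℤ) :
    ∫ x : AddCircle (2 * Real.pi), fourier n x = if n = 0 then ((2 * Real.pi : ℝ) : ℂ) else 0 := by
  rw [AddCircle.volume_eq_smul_haarAddCircle, integral_smul_measure]
  have h := orthonormal_iff_ite.mp (orthonormal_fourier (T := 2 * Real.pi)) 0 n
  rw [ContinuousMap.inner_toLp] at h
  have h2 : ∫ x : AddCircle (2 * Real.pi), fourier n x ∂AddCircle.haarAddCircle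
      = if (0 : ℤ) = n then 1 else 0 := by
    rw [← h]
    simp
  rw [h2, ENNReal.toReal_ofReal Real.two_pi_pos.le]
  simp [eq_comm]

lemma integral_mode (ξ : Fin d → ℤ) :
    ∫ x : Torus d, mode ξ x = if ξ = 0 then ((2 * Real.pi : ℝ) : ℂ) ^ d else 0 := by
  unfold mode
  rw [integral_fintype_prod_volume_eq_prod (fun j (x : AddCircle (2 * Real.pi)) => fourier (ξ j) x)]
  simp only [integral_fourier_eq_ite]
  split_ifs with h
  · simp [h]
  · obtain ⟨i, hi⟩ := Function.ne_iff.mp h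
    exact Finset.prod_eq_zero (Finset.mem_univ i) (by simpa using hi)

lemma inner_modeLp (ξ η : Fin d → ℤ) :
    inner ℂ (modeLp ξ) (modeLp η) = if ξ = η then ((2 * Real.pi : ℝ) : ℂ) ^ d else 0 := by
  rw [modeLp, modeLp, ContinuousMap.inner_toLp]
  simp only [modeC_apply, ← mode_neg, ← mode_add]
  rw [integral_mode]
  simp only [add_neg_eq_zero, eq_comm]

/-- The volume `(2π)^d` of the torus. -/
def torusVol (d : ℕ) : ℝ := (2 * Real.pi) ^ d

lemma torusVol_pos : 0 < torusVol d := pow_pos Real.two_pi_pos d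

lemma coeff_congr {f g : Torus d → ℂ} (h : f =ᵐ[volume] g) (ξ : Fin d → ℤ) :
    coeff f ξ = coeff g ξ := by
  rw [coeff, coeff]
  congr 1
  refine integral_congr_ae ?_
  filter_upwards [h] with x hx
  rw [hx]

lemma coeff_eq_inner (f : L2 d) (ξ : Fin d → ℤ) :
    coeff f ξ = (torusVol d : ℂ)⁻¹ * inner ℂ (modeLp ξ) f := by
  rw [coeff, torusVol, L2.inner_def]
  push_cast
  rw [inv_pow]
  congr 1
  refine integral_congr_ae ?_
  filter_upwards [coeFn_modeLp ξ] with x hx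
  rw [hx, RCLike.inner_apply, mul_comm]

/-- The normalised Fourier modes. -/
def unitMode (ξ : Fin d → ℤ) : L2 d := ((√(torusVol d) : ℝ) : ℂ)⁻¹ • modeLp ξ

lemma sqrt_torusVol_ne_zero : ((√(torusVol d) : ℝ) : ℂ) ≠ 0 := by
  have := Real.sqrt_pos.2 (torusVol_pos (d := d))
  exact_mod_cast this.ne'

lemma orthonormal_unitMode : Orthonormal ℂ (unitMode (d := d)) := by
  rw [orthonormal_iff_ite]
  intro ξ η
  rw [unitMode, unitMode, inner_smul_left, inner_smul_right, inner_modeLp]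
  split_ifs
  · have h : ((√(torusVol d) : ℝ) : ℂ) * ((√(torusVol d) : ℝ) : ℂ) = (2 * Real.pi : ℝ) ^ d := by
      rw [← Complex.ofReal_mul, Real.mul_self_sqrt torusVol_pos.le, torusVol]; push_cast; rfl
    rw [← h, map_inv₀, Complex.conj_ofReal]
    have := sqrt_torusVol_ne_zero (d := d)
    field_simp
  · simp

/-- The Hilbert basis of normalised Fourier modes. -/
def modeBasis (d : ℕ) : HilbertBasis (Fin d → ℤ) ℂ (L2 d) :=
  HilbertBasis.mk orthonormal_unitMode <| by
    rw [← span_modeLp_closure]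
    refine Submodule.topologicalClosure_mono ?_
    rw [Submodule.span_le]
    rintro _ ⟨ξ, rfl⟩
    have : modeLp ξ = ((√(torusVol d) : ℝ) : ℂ) • unitMode ξ := by
      rw [unitMode, smul_smul, mul_inv_cancel₀ sqrt_torusVol_ne_zero, one_smul]
    rw [this]
    exact Submodule.smul_mem _ _ (Submodule.subset_span ⟨ξ, rfl⟩)

lemma modeBasis_repr (f : L2 d) (ξ : Fin d → ℤ) :
    (modeBasis d).repr f ξ = ((√(torusVol d) : ℝ) : ℂ) * coeff f ξ := by
  rw [HilbertBasis.repr_apply_apply, modeBasis, HilbertBasis.coe_mk, unitMode, inner_smul_left,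
    coeff_eq_inner, map_inv₀, Complex.conj_ofReal, ← mul_assoc]
  congr 1
  have h : (torusVol d : ℂ) = ((√(torusVol d) : ℝ) : ℂ) * ((√(torusVol d) : ℝ) : ℂ) := by
    rw [← Complex.ofReal_mul, Real.mul_self_sqrt torusVol_pos.le]
  rw [h]
  have := sqrt_torusVol_ne_zero (d := d)
  field_simp

/-- An `L²` function is determined by its Fourier coefficients. -/
lemma ext_coeff {f g : L2 d} (h : ∀ ξ, coeff f ξ = coeff g ξ) : f = g := by
  apply (modeBasis d).repr.injective
  ext ξ
  rw [modeBasis_repr, modeBasis_repr, h]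

lemma memℓp_coeff (f : L2 d) : Memℓp (fun ξ => coeff f ξ) 2 := by
  have h := lp.memℓp ((modeBasis d).repr f)
  have := h.const_smul (((√(torusVol d) : ℝ) : ℂ)⁻¹)
  have he : (fun ξ => coeff f ξ) = ((√(torusVol d) : ℝ) : ℂ)⁻¹ • ⇑((modeBasis d).repr f) := by
    ext ξ
    rw [Pi.smul_apply, modeBasis_repr, smul_eq_mul, ← mul_assoc,
      inv_mul_cancel₀ sqrt_torusVol_ne_zero, one_mul]
  rwa [he]

/-- The Riesz–Fischer theorem. -/
lemma exists_coeff_eq {c : (Fin d → ℤ) → ℂ} (hc : Memℓp c 2) : ∃ f : L2 d, ∀ ξ, coeff f ξ = c ξ := by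
  have h := hc.const_smul ((√(torusVol d) : ℝ) : ℂ)
  refine ⟨(modeBasis d).repr.symm ⟨_, h⟩, fun ξ => ?_⟩
  have := modeBasis_repr ((modeBasis d).repr.symm ⟨_, h⟩) ξ
  rw [LinearIsometryEquiv.apply_symm_apply] at this
  exact (mul_left_cancel₀ sqrt_torusVol_ne_zero this).symm

lemma coeff_add (f g : L2 d) : coeff (f + g : L2 d) = coeff f + coeff g := by
  ext ξ; simp only [Pi.add_apply, coeff_eq_inner, inner_add_right, mul_add]

lemma coeff_sub (f g : L2 d) : coeff (f - g : L2 d) = coeff f - coeff g := by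
  ext ξ; simp only [Pi.sub_apply, coeff_eq_inner, inner_sub_right, mul_sub]

lemma coeff_smul (k : ℂ) (f : L2 d) : coeff (k • f : L2 d) = k • coeff f := by
  ext ξ; simp only [Pi.smul_apply, coeff_eq_inner, inner_smul_right, smul_eq_mul]; ring

lemma continuous_coeff (ξ : Fin d → ℤ) : Continuous fun f : L2 d => coeff f ξ := by
  simp only [coeff_eq_inner]
  fun_prop

/-- Bounded functions of the Laplacian act as Fourier multipliers. -/
lemma coeff_funLaplacian {F : ℂ → ℂ} {B : ℝ} (hF : ∀ x : ℝ, ‖F (-(x : ℂ))‖ ≤ B) (f : L2 d)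
    (ξ : Fin d → ℤ) : coeff (funLaplacian F f) ξ = F (-(freqSq ξ : ℂ)) * coeff f ξ := by
  have h : ∃ g : L2 d, ∀ ξ, coeff g ξ = F (-(freqSq ξ : ℂ)) * coeff f ξ := by
    apply exists_coeff_eq
    have h1 := (memℓp_coeff f).norm.const_smul B
    refine memℓp_gen ?_
    have h2 := (h1.summable (by norm_num))
    refine h2.of_nonneg_of_le (fun ξ => by positivity) fun ξ => ?_
    gcongr
    rw [norm_mul, Pi.smul_apply, smul_eq_mul, norm_mul, norm_norm]
    gcongr
    exact (hF _).trans (le_abs_self B)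
  rw [funLaplacian, dif_pos h]
  exact h.choose_spec ξ

/-! ### Functions with an absolutely convergent Fourier series -/

/-- `f` is almost everywhere the sum of the absolutely convergent Fourier series with
coefficients `a`. -/
structure HasFourier (f : Torus d → ℂ) (a : (Fin d → ℤ) → ℂ) : Prop where
  summable : Summable fun ξ => ‖a ξ‖
  ae_eq : f =ᵐ[volume] fun x => ∑' ξ, a ξ * mode ξ x

lemma summable_mul_mode {a : (Fin d → ℤ) → ℂ} (ha : Summable fun ξ => ‖a ξ‖) (x : Torus d) :
    Summable fun ξ => ‖a ξ * mode ξ x‖ := by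
  simpa [norm_mode] using ha

/-- The sum of an absolutely convergent Fourier series. -/
def fourierSum (a : (Fin d → ℤ) → ℂ) : C(Torus d, ℂ) := ∑' ξ, a ξ • modeC ξ

lemma summable_smul_modeC {a : (Fin d → ℤ) → ℂ} (ha : Summable fun ξ => ‖a ξ‖) :
    Summable fun ξ => a ξ • modeC ξ := by
  refine Summable.of_norm_bounded ha fun ξ => ?_
  rw [norm_smul]
  exact mul_le_of_le_one_right (norm_nonneg _) (norm_modeC_le ξ)

lemma fourierSum_apply {a : (Fin d → ℤ) → ℂ} (ha : Summable fun ξ => ‖a ξ‖) (x : Torus d) :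
    fourierSum a x = ∑' ξ, a ξ * mode ξ x := by
  have := (ContinuousMap.hasSum_apply (summable_smul_modeC ha).hasSum x).tsum_eq
  exact this.symm

/-- The series converges uniformly, and both the map into L² and the inner product with a mode are
continuous, so orthogonality can be applied term by term. -/
lemma coeff_toLp_fourierSum {a : (Fin d → ℤ) → ℂ} (ha : Summable fun ξ => ‖a ξ‖) (ξ : Fin d → ℤ) :
    coeff (ContinuousMap.toLp (E := ℂ) 2 volume ℂ (fourierSum a) : L2 d) ξ = a ξ := by
  have h := (summable_smul_modeC ha).hasSum
  have h2 := h.mapL (ContinuousMap.toLp (E := ℂ) 2 (volume : Measure (Torus d)) ℂ)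
  have h3 := h2.mapL (innerSL ℂ (modeLp ξ))
  have h4 := h3.tsum_eq
  rw [coeff_eq_inner]
  rw [innerSL_apply_apply] at h4
  change _ * inner ℂ (modeLp ξ) (ContinuousMap.toLp (E := ℂ) 2 volume ℂ (∑' ξ, a ξ • modeC ξ)) = _
  rw [← h4, tsum_eq_single ξ]
  · rw [map_smul, innerSL_apply_apply, inner_smul_right]
    change _ * (_ * inner ℂ (modeLp ξ) (modeLp ξ)) = _
    rw [inner_modeLp, if_pos rfl, torusVol]
    push_cast
    have : (2 * (Real.pi : ℂ)) ^ d ≠ 0 := by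
      have := (torusVol_pos (d := d)).ne'
      rw [torusVol] at this
      exact_mod_cast this
    field_simp
  · intro η hη
    rw [map_smul, innerSL_apply_apply, inner_smul_right]
    change _ * inner ℂ (modeLp ξ) (modeLp η) = _
    rw [inner_modeLp, if_neg hη.symm, mul_zero]

namespace HasFourier

variable {f g h : Torus d → ℂ} {a b c : (Fin d → ℤ) → ℂ}

lemma ae_eq_fourierSum (hf : HasFourier f a) : f =ᵐ[volume] fourierSum a := by
  filter_upwards [hf.ae_eq] with x hx
  rw [hx, fourierSum_apply hf.summable]

lemma coeff_eq (hf : HasFourier f a) (ξ : Fin d → ℤ) : coeff f ξ = a ξ := by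
  rw [← coeff_toLp_fourierSum hf.summable ξ]
  exact coeff_congr (hf.ae_eq_fourierSum.trans (ContinuousMap.coeFn_toLp volume _).symm) ξ

lemma toL2_eq (hf : HasFourier f a) :
    toL2 f = ContinuousMap.toLp (E := ℂ) 2 volume ℂ (fourierSum a) := by
  have h1 : MemLp (fourierSum a) 2 (volume : Measure (Torus d)) :=
    (Lp.memLp (ContinuousMap.toLp (E := ℂ) 2 volume ℂ (fourierSum a))).ae_eq
      (ContinuousMap.coeFn_toLp volume _)
  have h2 : MemLp f 2 volume := h1.ae_eq hf.ae_eq_fourierSum.symm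
  rw [toL2, dif_pos h2]
  apply Lp.ext
  exact h2.coeFn_toLp.trans (hf.ae_eq_fourierSum.trans (ContinuousMap.coeFn_toLp volume _).symm)

lemma coeff_toL2 (hf : HasFourier f a) : coeff (toL2 f) = a := by
  ext ξ
  rw [hf.toL2_eq, coeff_toLp_fourierSum hf.summable]

/-- `f` and the sum of its Fourier series have the same coefficients, hence agree in L² by
completeness of the modes. -/
lemma of_summable_coeff {f : L2 d} (hf : Summable fun ξ => ‖coeff f ξ‖) :
    HasFourier f (coeff f) := by
  refine ⟨hf, ?_⟩
  have : f = ContinuousMap.toLp (E := ℂ) 2 volume ℂ (fourierSum (coeff f)) :=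
    ext_coeff fun ξ => (coeff_toLp_fourierSum hf ξ).symm
  have h2 : f =ᵐ[volume] fourierSum (coeff f) := by
    conv_lhs => rw [this]
    exact ContinuousMap.coeFn_toLp volume _
  filter_upwards [h2] with x hx
  rw [hx, fourierSum_apply hf]

lemma congr (hf : HasFourier f a) (h : f =ᵐ[volume] g) : HasFourier g a :=
  ⟨hf.summable, h.symm.trans hf.ae_eq⟩

lemma unique (hf : HasFourier f a) (hf' : HasFourier f b) : a = b := by
  ext ξ; rw [← hf.coeff_eq, hf'.coeff_eq]

lemma conjugate (hf : HasFourier f a) : HasFourier (fun x => conj (f x)) (cstar a) := by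
  refine ⟨?_, ?_⟩
  · have := (Equiv.neg (Fin d → ℤ)).summable_iff.mpr hf.summable
    simpa [Function.comp_def, cstar] using this
  · filter_upwards [hf.ae_eq] with x hx
    rw [hx, Complex.conj_tsum, ← (Equiv.neg (Fin d → ℤ)).tsum_eq]
    refine tsum_congr fun ξ => ?_
    simp [cstar, mode_neg]

/-- The Fourier coefficients of a product of three functions. -/
lemma mul_mul (hf : HasFourier f a) (hg : HasFourier g b) (hh : HasFourier h c) :
    HasFourier (fun x => f x * g x * h x) (tri (fun _ _ _ => 1) a b c) := by
  refine ⟨summable_norm_tri (B := 1) (by simp) (by simp) hf.summable hg.summable hh.summable, ?_⟩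
  filter_upwards [hf.ae_eq, hg.ae_eq, hh.ae_eq] with x h1 h2 h3
  rw [h1, h2, h3]
  have s1 := summable_mul_mode hf.summable x
  have s2 := summable_mul_mode hg.summable x
  have s3 := summable_mul_mode hh.summable x
  have s12 := s1.mul_norm s2
  have s123 := s12.mul_norm s3
  rw [tsum_mul_tsum_of_summable_norm s1 s2, tsum_mul_tsum_of_summable_norm s12 s3]
  -- Triples of frequencies are reindexed by their total ξ and the first two of them; the third is
  -- then ξ minus these two.
  let e : (Fin d → ℤ) × ((Fin d → ℤ) × (Fin d → ℤ)) ≃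
      ((Fin d → ℤ) × (Fin d → ℤ)) × (Fin d → ℤ) :=
    { toFun := fun q => (q.2, q.1 - q.2.1 - q.2.2)
      invFun := fun q => (q.2 + q.1.2 + q.1.1, q.1)
      left_inv := fun q => by simp
      right_inv := fun q => by
        ext1
        · simp
        · simp only; abel }
  rw [← e.tsum_eq]
  refine ((e.summable_iff.mpr s123.of_norm).tsum_prod).trans ?_
  refine tsum_congr fun ξ => ?_
  rw [tri, ← tsum_mul_right]
  refine tsum_congr fun p => ?_
  have : mode ξ x = mode p.1 x * mode p.2 x * mode (ξ - p.1 - p.2) x := by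
    rw [← mode_add, ← mode_add]; congr 1; abel
  rw [this]
  simp only [Function.comp_apply, e, Equiv.coe_fn_mk]
  ring

end HasFourier

/-! ### A mean value inequality for sequences -/

section MeanValue

/-- The equation holds only at interior times. The mean value inequality is therefore applied on [δ,
T], and δ → 0 by continuity. -/
lemma norm_sub_le_of_hasDerivAt_Ioo {E : Type*} [NormedAddCommGroup E] [NormedSpace ℝ E]
    {f f' : ℝ → E} {T C : ℝ} (hT : 0 < T) (hf : ContinuousOn f (Set.Icc 0 T))
    (hf' : ∀ t ∈ Set.Ioo 0 T, HasDerivAt f (f' t) t) (hC : ∀ t ∈ Set.Ioo 0 T, ‖f' t‖ ≤ C) :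
    ‖f T - f 0‖ ≤ C * T := by
  have h (δ : ℝ) (hδ : δ ∈ Set.Ioo 0 T) : ‖f T - f δ‖ ≤ C * (T - δ) :=
    norm_image_sub_le_of_norm_deriv_right_le_segment
      (hf.mono (Set.Icc_subset_Icc_left hδ.1.le))
      (fun x hx => (hf' x ⟨hδ.1.trans_le hx.1, hx.2⟩).hasDerivWithinAt)
      (fun x hx => hC x ⟨hδ.1.trans_le hx.1, hx.2⟩) T ⟨hδ.2.le, le_rfl⟩
  have h0 : Filter.Tendsto f (nhdsWithin 0 (Set.Ioo 0 T)) (nhds (f 0)) :=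
    ((hf 0 ⟨le_rfl, hT.le⟩).mono Set.Ioo_subset_Icc_self)
  have hne : (nhdsWithin (0 : ℝ) (Set.Ioo 0 T)).NeBot := by
    rw [← mem_closure_iff_nhdsWithin_neBot, closure_Ioo hT.ne]
    exact ⟨le_rfl, hT.le⟩
  have hid : Filter.Tendsto (fun δ : ℝ => C * (T - δ)) (nhdsWithin 0 (Set.Ioo 0 T))
      (nhds (C * (T - 0))) :=
    (by fun_prop : Continuous fun δ : ℝ => C * (T - δ)).continuousAt.mono_left nhdsWithin_le_nhds
  rw [sub_zero] at hid
  exact le_of_tendsto_of_tendsto (h0.const_sub (f T)).norm hid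
    (Filter.eventually_of_mem self_mem_nhdsWithin h)

/-- A finite truncation of the Sobolev norm is a Euclidean norm, to which calculus in normed spaces
applies. -/
lemma sum_sq_wt_enorm (s : ℝ) (S : Finset (Fin d → ℤ)) (a : (Fin d → ℤ) → ℂ) :
    ∑ ξ ∈ S, (wt s ξ * ‖a ξ‖ₑ) ^ 2 =
      ‖(WithLp.toLp 2 fun ξ : S => (((1 + freqSq ξ.1) ^ (s / 2) : ℝ) : ℂ) * a ξ :
        EuclideanSpace ℂ S)‖ₑ ^ 2 := by
  have h : ‖(WithLp.toLp 2 fun ξ : S => (((1 + freqSq ξ.1) ^ (s / 2) : ℝ) : ℂ) * a ξ :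
        EuclideanSpace ℂ S)‖ ^ 2 = ∑ ξ ∈ S, ((1 + freqSq ξ) ^ (s / 2) * ‖a ξ‖) ^ 2 := by
    rw [EuclideanSpace.norm_sq_eq, ← Finset.sum_coe_sort S]
    refine Finset.sum_congr rfl fun ξ _ => ?_
    have := one_add_freqSq_pos ξ.1
    rw [norm_mul, Complex.norm_of_nonneg (by positivity)]
  rw [← ofReal_norm, ← ENNReal.ofReal_pow (norm_nonneg _), h,
    ENNReal.ofReal_sum_of_nonneg fun _ _ => sq_nonneg _]
  refine Finset.sum_congr rfl fun ξ _ => ?_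
  have := one_add_freqSq_pos ξ
  rw [ENNReal.ofReal_pow (by positivity), ENNReal.ofReal_mul (by positivity), ofReal_norm, wt]

lemma seqNorm_le_of_forall_finset {s : ℝ} {a : (Fin d → ℤ) → ℂ} {C : ℝ≥0∞}
    (h : ∀ S : Finset (Fin d → ℤ), ∑ ξ ∈ S, (wt s ξ * ‖a ξ‖ₑ) ^ 2 ≤ C ^ 2) :
    seqNorm s a ≤ C := by
  apply le_of_sq_le_sq
  rw [seqNorm, l2_sq, ENNReal.tsum_eq_iSup_sum]
  exact iSup_le h

lemma sum_sq_le_seqNorm_sq (s : ℝ) (a : (Fin d → ℤ) → ℂ) (S : Finset (Fin d → ℤ)) :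
    ∑ ξ ∈ S, (wt s ξ * ‖a ξ‖ₑ) ^ 2 ≤ seqNorm s a ^ 2 := by
  rw [seqNorm, l2_sq]
  exact ENNReal.sum_le_tsum S

/-- The mean value inequality on each finite set of frequencies has a bound independent of the set.
Differentiability of each coefficient is enough: neither H^s-valued derivatives nor integrals occur.
-/
lemma seqNorm_sub_le_of_hasDerivAt {s T : ℝ} {C : ℝ≥0∞} (hC : C ≠ ∞) (hT : 0 ≤ T)
    {a a' : ℝ → (Fin d → ℤ) → ℂ} (ha : ∀ ξ, ContinuousOn (fun t => a t ξ) (Set.Icc 0 T))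
    (ha' : ∀ t ∈ Set.Ioo 0 T, ∀ ξ, HasDerivAt (fun t => a t ξ) (a' t ξ) t)
    (hb : ∀ t ∈ Set.Ioo 0 T, seqNorm s (a' t) ≤ C) :
    seqNorm s (a T - a 0) ≤ C * ENNReal.ofReal T := by
  rcases hT.eq_or_lt with rfl | hT
  · simp [seqNorm_zero]
  refine seqNorm_le_of_forall_finset fun S => ?_
  set F : ((Fin d → ℤ) → ℂ) → EuclideanSpace ℂ S := fun b =>
    WithLp.toLp 2 fun ξ : S => (((1 + freqSq ξ.1) ^ (s / 2) : ℝ) : ℂ) * b ξ with hF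
  have key : ‖F (a T) - F (a 0)‖ ≤ C.toReal * T := by
    refine norm_sub_le_of_hasDerivAt_Ioo (f := fun t => F (a t)) (f' := fun t => F (a' t)) hT
      ?_ ?_ ?_
    · refine (PiLp.continuous_toLp 2 _).comp_continuousOn ?_
      exact continuousOn_pi.2 fun ξ => continuousOn_const.mul (ha ξ)
    · intro t ht
      have h : HasDerivAt (fun t => fun ξ : S => (((1 + freqSq ξ.1) ^ (s / 2) : ℝ) : ℂ) * a t ξ)
          (fun ξ : S => (((1 + freqSq ξ.1) ^ (s / 2) : ℝ) : ℂ) * a' t ξ) t :=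
        hasDerivAt_pi.2 fun ξ => (ha' t ht ξ).const_mul _
      exact ((PiLp.continuousLinearEquiv 2 ℝ fun _ : S => ℂ).symm.hasFDerivAt.comp_hasDerivAt t h)
    · intro t ht
      have h1 : ‖F (a' t)‖ₑ ^ 2 ≤ C ^ 2 := by
        rw [hF, ← sum_sq_wt_enorm]
        exact (sum_sq_le_seqNorm_sq s _ S).trans (pow_le_pow_left' (hb t ht) 2)
      have h2 := ENNReal.toReal_mono hC (le_of_sq_le_sq h1)
      simpa using h2
  rw [sum_sq_wt_enorm]
  refine pow_le_pow_left' ?_ 2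
  have : F (a T) - F (a 0) = F (a T - a 0) := by
    ext ξ; simp [hF, mul_sub]
  rw [this] at key
  calc ‖F (a T - a 0)‖ₑ = ENNReal.ofReal ‖F (a T - a 0)‖ := (ofReal_norm _).symm
    _ ≤ ENNReal.ofReal (C.toReal * T) := ENNReal.ofReal_le_ofReal key
    _ = _ := by rw [ENNReal.ofReal_mul ENNReal.toReal_nonneg, ENNReal.ofReal_toReal hC]

end MeanValue

/-! ### The symbols of the integrator -/

section Phi

open Complex

/-- `s φ(2isx) = ∫₀ˢ e^{2irx} dr`. -/
lemma hasDerivAt_mul_phi (x s : ℝ) :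
    HasDerivAt (fun s : ℝ => (s : ℂ) * phi (2 * I * s * x)) (exp (2 * I * s * x)) s := by
  rcases eq_or_ne x 0 with rfl | hx
  · simpa [phi] using (hasDerivAt_id s).ofReal_comp
  have hx' : (2 * I * x : ℂ) ≠ 0 := by simp [hx]
  have h1 : (fun s : ℝ => (s : ℂ) * phi (2 * I * s * x))
      = fun s : ℝ => (exp (2 * I * s * x) - 1) / (2 * I * x) := by
    ext r
    rcases eq_or_ne r 0 with rfl | hr
    · simp
    have : (r : ℂ) ≠ 0 := by exact_mod_cast hr
    have hxc : (x : ℂ) ≠ 0 := by exact_mod_cast hx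
    rw [phi, if_neg (by simp [hr, hx])]
    field_simp
  rw [h1]
  have h2 : HasDerivAt (fun s : ℝ => 2 * I * (s : ℂ) * x) (2 * I * x) s := by
    have := (((hasDerivAt_id s).ofReal_comp).const_mul (2 * I)).mul_const (x : ℂ)
    simpa using this
  have h3 := (h2.cexp.sub_const 1).div_const (2 * I * x)
  rwa [mul_div_assoc, div_self hx', mul_one] at h3

/-- `-s² ψ(2isx) = ∫₀ˢ r e^{2irx} dr`. -/
lemma hasDerivAt_sq_mul_psi (x s : ℝ) :
    HasDerivAt (fun s : ℝ => -(s : ℂ) ^ 2 * psi (2 * I * s * x)) (s * exp (2 * I * s * x)) s := by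
  have hid := (hasDerivAt_id s).ofReal_comp
  simp only [id] at hid
  rcases eq_or_ne x 0 with rfl | hx
  · have := (hid.pow 2).neg.mul_const (-1 / 2 : ℂ)
    simp only [psi, ofReal_zero, mul_zero, if_true, Complex.exp_zero]
    exact this.congr_deriv (by push_cast; ring)
  have hx' : (2 * I * x : ℂ) ≠ 0 := by simp [hx]
  have hxc : (x : ℂ) ≠ 0 := by exact_mod_cast hx
  have h1 : (fun s : ℝ => -(s : ℂ) ^ 2 * psi (2 * I * s * x))
      = fun s : ℝ => (2 * I * s * x * exp (2 * I * s * x) - exp (2 * I * s * x) + 1)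
          / (2 * I * x) ^ 2 := by
    ext r
    rcases eq_or_ne r 0 with rfl | hr
    · simp
    have : (r : ℂ) ≠ 0 := by exact_mod_cast hr
    rw [psi, if_neg (by simp [hr, hx])]
    have hI := I_ne_zero
    field_simp
    ring
  rw [h1]
  have h2 : HasDerivAt (fun s : ℝ => 2 * I * (s : ℂ) * x) (2 * I * x) s := by
    have := (hid.const_mul (2 * I)).mul_const (x : ℂ)
    simpa using this
  have h3 := (((h2.mul h2.cexp).sub h2.cexp).add_const 1).div_const ((2 * I * x) ^ 2)
  refine h3.congr_deriv ?_
  have hI := I_ne_zero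
  field_simp
  ring

lemma norm_exp_two_I (s x : ℝ) : ‖exp (2 * I * s * x)‖ = 1 := by
  rw [show (2 * I * s * x : ℂ) = ((2 * s * x : ℝ) : ℂ) * I by push_cast; ring]
  exact norm_exp_ofReal_mul_I _

/-- φ(2ix) is the mean of the unimodular function e^{2irx} over 0 ≤ r ≤ 1. For ψ the integrand
carries the extra factor r ≤ 1. -/
lemma norm_phi_le (x : ℝ) : ‖phi (2 * I * x)‖ ≤ 1 := by
  have := norm_sub_le_of_hasDerivAt_Ioo (C := 1) one_pos
    (fun s _ => (hasDerivAt_mul_phi x s).continuousAt.continuousWithinAt)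
    (fun s _ => hasDerivAt_mul_phi x s) fun s _ => (norm_exp_two_I s x).le
  simpa using this

lemma norm_psi_le (x : ℝ) : ‖psi (2 * I * x)‖ ≤ 1 := by
  have := norm_sub_le_of_hasDerivAt_Ioo (C := 1) one_pos
    (fun s _ => (hasDerivAt_sq_mul_psi x s).continuousAt.continuousWithinAt)
    (fun s _ => hasDerivAt_sq_mul_psi x s) fun s hs => by
      rw [norm_mul, norm_exp_two_I, mul_one, norm_real, Real.norm_of_nonneg hs.1.le]
      exact hs.2.le
  simpa using this

end Phi

/-! ### The resonance function and the approximation of the phase -/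

section Symbols

open Complex

/-- The resonance function `|ξ + η + ζ|² - |ξ|² - |η|² - |ζ|²`. -/
def beta (ξ η ζ : Fin d → ℤ) : ℝ := freqSq (ξ + η + ζ) - freqSq ξ - freqSq η - freqSq ζ

lemma beta_eq (ξ η ζ : Fin d → ℤ) :
    beta ξ η ζ = 2 * ∑ j, ((ξ j : ℝ) * η j + ξ j * ζ j + η j * ζ j) := by
  simp only [beta, freqSq, ← Finset.sum_sub_distrib, Finset.mul_sum]
  refine Finset.sum_congr rfl fun j _ => ?_
  push_cast [Pi.add_apply]; ring

lemma abs_beta_le (ξ η ζ : Fin d → ℤ) :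
    |beta ξ η ζ| ≤ 2 * (freqSq ξ + freqSq η + freqSq ζ) := by
  rw [beta_eq, freqSq, freqSq, freqSq, ← Finset.sum_add_distrib, ← Finset.sum_add_distrib,
    abs_le]
  constructor
  · rw [← mul_neg, ← Finset.sum_neg_distrib]
    refine mul_le_mul_of_nonneg_left (Finset.sum_le_sum fun j _ => ?_) (by norm_num)
    nlinarith [sq_nonneg ((ξ j : ℝ) + η j + ζ j), sq_nonneg (ξ j : ℝ), sq_nonneg (η j : ℝ),
      sq_nonneg (ζ j : ℝ)]
  · refine mul_le_mul_of_nonneg_left (Finset.sum_le_sum fun j _ => ?_) (by norm_num)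
    nlinarith [sq_nonneg ((ξ j : ℝ) - η j), sq_nonneg ((ξ j : ℝ) - ζ j),
      sq_nonneg ((η j : ℝ) - ζ j)]

/-- Only scalar products of distinct frequencies occur in β, so Cauchy–Schwarz bounds β² with each
|·|² appearing at most to the first power. The square of `alpha` would contain |ξ|⁴ and cost four
derivatives. The constant is 2²·3. -/
lemma sq_beta_le (ξ η ζ : Fin d → ℤ) :
    beta ξ η ζ ^ 2 ≤ 12 * ((1 + freqSq ξ) * (1 + freqSq η) * (1 + freqSq ζ)) := by
  have h1 := Finset.sum_mul_sq_le_sq_mul_sq Finset.univ (fun j => (ξ j : ℝ)) fun j => (η j : ℝ)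
  have h2 := Finset.sum_mul_sq_le_sq_mul_sq Finset.univ (fun j => (ξ j : ℝ)) fun j => (ζ j : ℝ)
  have h3 := Finset.sum_mul_sq_le_sq_mul_sq Finset.univ (fun j => (η j : ℝ)) fun j => (ζ j : ℝ)
  rw [beta_eq, Finset.sum_add_distrib, Finset.sum_add_distrib]
  simp only [← freqSq.eq_1] at h1 h2 h3
  set A := ∑ j, (ξ j : ℝ) * η j
  set B := ∑ j, (ξ j : ℝ) * ζ j
  set C := ∑ j, (η j : ℝ) * ζ j
  have hx := freqSq_nonneg ξ
  have hy := freqSq_nonneg η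
  have hz := freqSq_nonneg ζ
  have hxy := mul_nonneg hx hy
  nlinarith [sq_nonneg (A - B), sq_nonneg (A - C), sq_nonneg (B - C), mul_nonneg hxy hz,
    mul_nonneg hx hz, mul_nonneg hy hz]

/-- The phase `|ξ + η + ζ|² + |ξ|² - |η|² - |ζ|²` of the cubic nonlinearity. -/
def alpha (ξ η ζ : Fin d → ℤ) : ℝ := 2 * freqSq ξ + beta ξ η ζ

lemma abs_alpha_le (ξ η ζ : Fin d → ℤ) :
    |alpha ξ η ζ| ≤ 4 * ((1 + freqSq ξ) * (1 + freqSq η) * (1 + freqSq ζ)) := by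
  have h := abs_beta_le ξ η ζ
  have hx := freqSq_nonneg ξ
  have hy := freqSq_nonneg η
  have hz := freqSq_nonneg ζ
  have hxy := mul_nonneg hx hy
  have h1 : |alpha ξ η ζ| ≤ 2 * freqSq ξ + |beta ξ η ζ| := by
    refine (abs_add_le _ _).trans ?_
    rw [abs_of_nonneg (by positivity)]
  nlinarith [mul_nonneg hxy hz, mul_nonneg hx hz, mul_nonneg hy hz]

lemma wt_two_mul (ξ η ζ : Fin d → ℤ) : wt 2 ξ * wt 2 η * wt 2 ζ
    = ENNReal.ofReal ((1 + freqSq ξ) * (1 + freqSq η) * (1 + freqSq ζ)) := by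
  have := one_add_freqSq_pos ξ
  have := one_add_freqSq_pos η
  rw [wt_two, wt_two, wt_two, ENNReal.ofReal_mul (by positivity), ENNReal.ofReal_mul (by positivity)]

lemma enorm_le_ofReal {z : ℂ} {B : ℝ} (h : ‖z‖ ≤ B) : ‖z‖ₑ ≤ ENNReal.ofReal B := by
  rw [← ofReal_norm]; exact ENNReal.ofReal_le_ofReal h

lemma norm_exp_I (x : ℝ) : ‖exp (I * x)‖ = 1 := by
  rw [mul_comm]; exact norm_exp_ofReal_mul_I x

lemma norm_exp_I_sub_one_le (x : ℝ) : ‖exp (I * x) - 1‖ ≤ |x| := by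
  simpa using Real.norm_exp_I_mul_ofReal_sub_one_le (x := x)

lemma norm_exp_I_sub_one_sub_le (x : ℝ) : ‖exp (I * x) - 1 - I * x‖ ≤ x ^ 2 := by
  wlog hx : 0 ≤ x generalizing x
  · have := this (-x) (by linarith)
    rw [← Complex.norm_conj] at this
    simpa [← exp_conj, sub_eq_add_neg] using this
  rcases hx.eq_or_lt with rfl | hx
  · simp
  have hd (s : ℝ) : HasDerivAt (fun s : ℝ => exp (I * s) - 1 - I * s) (I * (exp (I * s) - 1)) s := by
    have h2 : HasDerivAt (fun s : ℝ => I * (s : ℂ)) I s := by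
      simpa using ((hasDerivAt_id s).ofReal_comp).const_mul I
    exact ((h2.cexp.sub_const 1).sub h2).congr_deriv (by ring)
  have := norm_sub_le_of_hasDerivAt_Ioo (C := x) hx
    (fun s _ => (hd s).continuousAt.continuousWithinAt) (fun s _ => hd s) fun s hs => by
      rw [norm_mul, norm_I, one_mul]
      refine (norm_exp_I_sub_one_le s).trans ?_
      rw [abs_of_pos hs.1]; exact hs.2.le
  simpa [sq] using this

/-- The symbol of the nonlinearity in the interaction picture. -/
def phaseSym (s : ℝ) (ξ η ζ : Fin d → ℤ) : ℂ := exp (I * (s * alpha ξ η ζ : ℝ))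

/-- The symbol that approximates `phaseSym` on `[0, τ]`. -/
def approxSym (τ s : ℝ) (ξ η ζ : Fin d → ℤ) : ℂ :=
  exp (2 * I * s * freqSq ξ) + (s * exp (2 * I * s * freqSq ξ)) *
    ((exp (I * (τ * beta ξ η ζ : ℝ)) - 1) / τ)

/-- The primitive of `approxSym`. -/
def primSym (τ s : ℝ) (ξ η ζ : Fin d → ℤ) : ℂ :=
  s * phi (2 * I * s * freqSq ξ) + (-(s : ℂ) ^ 2 * psi (2 * I * s * freqSq ξ)) *
    ((exp (I * (τ * beta ξ η ζ : ℝ)) - 1) / τ)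

lemma hasDerivAt_primSym (τ s : ℝ) (ξ η ζ : Fin d → ℤ) :
    HasDerivAt (fun s => primSym τ s ξ η ζ) (approxSym τ s ξ η ζ) s :=
  (hasDerivAt_mul_phi _ s).add ((hasDerivAt_sq_mul_psi _ s).mul_const _)

lemma primSym_zero (τ : ℝ) (ξ η ζ : Fin d → ℤ) : primSym τ 0 ξ η ζ = 0 := by simp [primSym]

/-- The range |s| ≤ 2τ leaves an open neighbourhood of [0, τ] for differentiation under the sum. The
bound is 5 = 1 + 2·2. -/
lemma norm_approxSym_le {τ s : ℝ} (hτ : 0 < τ) (hs : |s| ≤ 2 * τ) (ξ η ζ : Fin d → ℤ) :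
    ‖approxSym τ s ξ η ζ‖ ≤ 5 := by
  rw [approxSym]
  refine (norm_add_le _ _).trans ?_
  rw [norm_mul, norm_mul, norm_exp_two_I, norm_div, norm_real, norm_real, Real.norm_eq_abs,
    Real.norm_of_nonneg hτ.le]
  have h : ‖exp (I * (τ * beta ξ η ζ : ℝ)) - 1‖ ≤ 2 := by
    refine (norm_sub_le _ _).trans ?_
    rw [norm_exp_I, norm_one]; norm_num
  have : |s| * 1 * (‖exp (I * (τ * beta ξ η ζ : ℝ)) - 1‖ / τ) ≤ 2 * τ * 1 * (2 / τ) := by gcongr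
  have h2 : 2 * τ * 1 * (2 / τ) = 4 := by field_simp; norm_num
  linarith

lemma norm_phaseSym (s : ℝ) (ξ η ζ : Fin d → ℤ) : ‖phaseSym s ξ η ζ‖ = 1 := norm_exp_I _

lemma norm_phaseSym_sub_one_le {s : ℝ} (hs : 0 ≤ s) (ξ η ζ : Fin d → ℤ) :
    ‖phaseSym s ξ η ζ - 1‖ ≤ 4 * s * ((1 + freqSq ξ) * (1 + freqSq η) * (1 + freqSq ζ)) := by
  refine (norm_exp_I_sub_one_le _).trans ?_
  rw [abs_mul, abs_of_nonneg hs]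
  nlinarith [abs_alpha_le ξ η ζ]

/-- Apart from the common factor e^{2is|ξ|²}, this is the error of interpolating e^{isβ} linearly at
0 and τ. The terms isβ cancel, leaving two second-order remainders, each at most τ²β² ≤ 12τ²(⋯). -/
lemma norm_phaseSym_sub_approxSym_le {τ s : ℝ} (hτ : 0 < τ) (hs : 0 ≤ s) (hsτ : s ≤ τ)
    (ξ η ζ : Fin d → ℤ) :
    ‖phaseSym s ξ η ζ - approxSym τ s ξ η ζ‖
      ≤ 24 * τ ^ 2 * ((1 + freqSq ξ) * (1 + freqSq η) * (1 + freqSq ζ)) := by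
  set b := beta ξ η ζ with hb
  have hτ' : (τ : ℂ) ≠ 0 := by exact_mod_cast hτ.ne'
  have h1 : phaseSym s ξ η ζ - approxSym τ s ξ η ζ = exp (2 * I * s * freqSq ξ) *
      ((exp (I * (s * b : ℝ)) - 1 - I * (s * b : ℝ))
        - (s / τ : ℂ) * (exp (I * (τ * b : ℝ)) - 1 - I * (τ * b : ℝ))) := by
    have : phaseSym s ξ η ζ = exp (2 * I * s * freqSq ξ) * exp (I * (s * b : ℝ)) := by
      rw [phaseSym, ← Complex.exp_add, alpha, ← hb]; congr 1; push_cast; ring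
    rw [this, approxSym, ← hb]
    push_cast
    field_simp
    ring
  rw [h1, norm_mul, norm_exp_two_I, one_mul]
  have h2 := norm_exp_I_sub_one_sub_le (s * b)
  have h3 := norm_exp_I_sub_one_sub_le (τ * b)
  have h4 : ‖(s / τ : ℂ)‖ ≤ 1 := by
    rw [norm_div, norm_real, norm_real, Real.norm_of_nonneg hs, Real.norm_of_nonneg hτ.le]
    exact (div_le_one hτ).2 hsτ
  refine (norm_sub_le _ _).trans ?_
  rw [norm_mul]
  have h5 := mul_le_of_le_one_left (norm_nonneg (exp (I * (τ * b : ℝ)) - 1 - I * (τ * b : ℝ))) h4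
  have h6 : (s * b) ^ 2 ≤ (τ * b) ^ 2 := by
    rw [mul_pow, mul_pow]; gcongr
  have h7 : τ ^ 2 * b ^ 2 ≤ τ ^ 2 * (12 * ((1 + freqSq ξ) * (1 + freqSq η) * (1 + freqSq ζ))) := by
    gcongr; exact sq_beta_le ξ η ζ
  nlinarith

end Symbols

/-! ### The local error -/

/-- The constant symbol of the pointwise product. -/
abbrev oneSym : (Fin d → ℤ) → (Fin d → ℤ) → (Fin d → ℤ) → ℂ := fun _ _ _ => 1

/-- The Fourier coefficients of `|f|² f`. -/
def cubic (a : (Fin d → ℤ) → ℂ) : (Fin d → ℤ) → ℂ := tri oneSym (cstar a) a a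

/-- The Fourier coefficients of `|f|⁴ f`. -/
def quintic (a : (Fin d → ℤ) → ℂ) : (Fin d → ℤ) → ℂ := tri oneSym (cstar a) (cubic a) a

/-- `e^{-iτΔ}` applied to one step of the integrator, in terms of Fourier coefficients. -/
def stepSeq (τ : ℝ) (a : (Fin d → ℤ) → ℂ) : (Fin d → ℤ) → ℂ :=
  a + Complex.I • tri (primSym τ τ) (cstar a) a a - ((τ : ℂ) ^ 2 / 2) • quintic a

/-- `K` bounds trilinear operators with bounded symbols on `H^γ`. -/
def TriBound (d : ℕ) (γ : ℝ) (K : ℝ≥0∞) : Prop :=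
  ∀ (m : (Fin d → ℤ) → (Fin d → ℤ) → (Fin d → ℤ) → ℂ) (B : ℝ≥0∞),
    (∀ ξ η ζ, ‖m ξ η ζ‖ₑ ≤ B) → ∀ a b c : (Fin d → ℤ) → ℂ,
      seqNorm γ (tri m a b c) ≤ K * B * (seqNorm γ a * seqNorm γ b * seqNorm γ c)

/-- `K` bounds trilinear operators losing two derivatives in each variable. -/
def TriGrowthBound (d : ℕ) (γ : ℝ) (K : ℝ≥0∞) : Prop :=
  ∀ (m : (Fin d → ℤ) → (Fin d → ℤ) → (Fin d → ℤ) → ℂ) (B : ℝ≥0∞),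
    (∀ ξ η ζ, ‖m ξ η ζ‖ₑ ≤ B * (wt 2 ξ * wt 2 η * wt 2 ζ)) → ∀ a b c : (Fin d → ℤ) → ℂ,
      seqNorm γ (tri m a b c)
        ≤ K * B * (seqNorm (γ + 2) a * seqNorm (γ + 2) b * seqNorm (γ + 2) c)

lemma summable_cstar {a : (Fin d → ℤ) → ℂ} (ha : Summable fun ξ => ‖a ξ‖) :
    Summable fun ξ => ‖cstar a ξ‖ := by
  have := (Equiv.neg (Fin d → ℤ)).summable_iff.mpr ha
  simpa [Function.comp_def, cstar] using this

lemma summable_norm_sub {a b : (Fin d → ℤ) → ℂ} (ha : Summable fun ξ => ‖a ξ‖)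
    (hb : Summable fun ξ => ‖b ξ‖) : Summable fun ξ => ‖(a - b) ξ‖ :=
  (ha.add hb).of_nonneg_of_le (fun _ => norm_nonneg _) fun _ => norm_sub_le _ _

lemma summable_norm_smul (k : ℂ) {a : (Fin d → ℤ) → ℂ} (ha : Summable fun ξ => ‖a ξ‖) :
    Summable fun ξ => ‖(k • a) ξ‖ := by
  simpa [norm_smul] using ha.mul_left ‖k‖

lemma summable_cubic {a : (Fin d → ℤ) → ℂ} (ha : Summable fun ξ => ‖a ξ‖) :
    Summable fun ξ => ‖cubic a ξ‖ :=
  summable_norm_tri (B := 1) (by simp) (by simp) (summable_cstar ha) ha ha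

/-! ### First- and second-order differences of trilinear operators -/

section Expansion

variable {m : (Fin d → ℤ) → (Fin d → ℤ) → (Fin d → ℤ) → ℂ} {B : ℝ≥0∞}
  {a b c a' b' c' : (Fin d → ℤ) → ℂ}

lemma tri_sub_tri (hm : ∀ ξ η ζ, ‖m ξ η ζ‖ₑ ≤ B) (hB : B ≠ ∞)
    (ha : Summable fun ξ => ‖a ξ‖) (hb : Summable fun ξ => ‖b ξ‖)
    (hc : Summable fun ξ => ‖c ξ‖) (ha' : Summable fun ξ => ‖a' ξ‖)
    (hb' : Summable fun ξ => ‖b' ξ‖) (hc' : Summable fun ξ => ‖c' ξ‖) :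
    tri m a b c - tri m a' b' c'
      = tri m (a - a') b c + tri m a' (b - b') c + tri m a' b' (c - c') := by
  rw [tri_sub_left hm hB ha ha' hb hc, tri_sub_mid hm hB ha' hb hb' hc,
    tri_sub_right hm hB ha' hb' hc hc']
  abel

/-- The first group is the linear part at the base point (a', b', c'); every term of the second
group contains two increments. -/
lemma tri_taylor (hm : ∀ ξ η ζ, ‖m ξ η ζ‖ₑ ≤ B) (hB : B ≠ ∞)
    (ha : Summable fun ξ => ‖a ξ‖) (hb : Summable fun ξ => ‖b ξ‖)
    (hc : Summable fun ξ => ‖c ξ‖) (ha' : Summable fun ξ => ‖a' ξ‖)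
    (hb' : Summable fun ξ => ‖b' ξ‖) (hc' : Summable fun ξ => ‖c' ξ‖) :
    tri m a b c - tri m a' b' c'
      = (tri m (a - a') b' c' + tri m a' (b - b') c' + tri m a' b' (c - c'))
        + (tri m (a - a') (b - b') c + tri m (a - a') b' (c - c')
          + tri m a' (b - b') (c - c')) := by
  have hx := summable_norm_sub ha ha'
  have hy := summable_norm_sub hb hb'
  rw [tri_sub_mid hm hB hx hb hb' hc, tri_sub_right hm hB hx hb' hc hc',
    tri_sub_right hm hB ha' hy hc hc', tri_sub_right hm hB ha' hb' hc hc',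
    tri_sub_mid hm hB ha' hb hb' hc, tri_sub_mid hm hB ha' hb hb' hc',
    tri_sub_left hm hB ha ha' hb hc, tri_sub_left hm hB ha ha' hb' hc,
    tri_sub_left hm hB ha ha' hb' hc']
  abel

lemma seqNorm_tri_sub_tri_le {γ : ℝ} {K : ℝ≥0∞} (hK : TriBound d γ K)
    (hm : ∀ ξ η ζ, ‖m ξ η ζ‖ₑ ≤ B) (hB : B ≠ ∞)
    (ha : Summable fun ξ => ‖a ξ‖) (hb : Summable fun ξ => ‖b ξ‖)
    (hc : Summable fun ξ => ‖c ξ‖) (ha' : Summable fun ξ => ‖a' ξ‖)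
    (hb' : Summable fun ξ => ‖b' ξ‖) (hc' : Summable fun ξ => ‖c' ξ‖) {R δ : ℝ≥0∞}
    (hbR : seqNorm γ b ≤ R) (hcR : seqNorm γ c ≤ R)
    (haR' : seqNorm γ a' ≤ R) (hbR' : seqNorm γ b' ≤ R) (haδ : seqNorm γ (a - a') ≤ δ)
    (hbδ : seqNorm γ (b - b') ≤ δ) (hcδ : seqNorm γ (c - c') ≤ δ) :
    seqNorm γ (tri m a b c - tri m a' b' c') ≤ 3 * K * B * R ^ 2 * δ := by
  rw [tri_sub_tri hm hB ha hb hc ha' hb' hc']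
  calc _ ≤ K * B * (δ * R * R) + K * B * (R * δ * R) + K * B * (R * R * δ) := by
        refine (seqNorm_add_le _ _ _).trans (add_le_add ((seqNorm_add_le _ _ _).trans
          (add_le_add ?_ ?_)) ?_) <;>
        · refine (hK m B hm _ _ _).trans ?_
          gcongr
    _ = _ := by ring

end Expansion

lemma hasFourier_fourierSum {a : (Fin d → ℤ) → ℂ} (ha : Summable fun ξ => ‖a ξ‖) :
    HasFourier (fourierSum a) a :=
  ⟨ha, Filter.Eventually.of_forall fun x => fourierSum_apply ha x⟩

/-- In physical space both sides are |f|⁴f, and Fourier coefficients are unique; no rearrangement of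
sums is needed. -/
lemma tri_cstar_cubic {a : (Fin d → ℤ) → ℂ} (ha : Summable fun ξ => ‖a ξ‖) :
    tri oneSym (cstar (cubic a)) a a = quintic a := by
  have h := hasFourier_fourierSum ha
  have h3 := h.conjugate.mul_mul h h
  refine (h3.conjugate.mul_mul h h).unique ((h.conjugate.mul_mul h3 h).congr ?_)
  refine Filter.Eventually.of_forall fun x => ?_
  simp only [map_mul, Complex.conj_conj]
  ring

lemma tri_cubic_right {a : (Fin d → ℤ) → ℂ} (ha : Summable fun ξ => ‖a ξ‖) :
    tri oneSym (cstar a) a (cubic a) = quintic a := by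
  have h := hasFourier_fourierSum ha
  have h3 := h.conjugate.mul_mul h h
  refine (h.conjugate.mul_mul h h3).unique ((h.conjugate.mul_mul h3 h).congr ?_)
  refine Filter.Eventually.of_forall fun x => ?_
  ring

/-- Termwise differentiation, dominated by five times the convergent sum with constant symbol. -/
lemma hasDerivAt_tri_primSym {τ s : ℝ} (hτ : 0 < τ) (hs : |s| < 2 * τ) {a b c : (Fin d → ℤ) → ℂ}
    (ha : Summable fun ξ => ‖a ξ‖) (hb : Summable fun ξ => ‖b ξ‖)
    (hc : Summable fun ξ => ‖c ξ‖) (ξ : Fin d → ℤ) :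
    HasDerivAt (fun s => tri (primSym τ s) a b c ξ) (tri (approxSym τ s) a b c ξ) s := by
  have hsum := (summable_tri_norm (m := oneSym) (B := 1) (by simp) (by simp) ha hb hc ξ).mul_left 5
  refine hasDerivAt_tsum_of_isPreconnected (t := Metric.ball 0 (2 * τ)) (y₀ := 0) hsum
    Metric.isOpen_ball (convex_ball 0 _).isPreconnected
    (fun p y _ => (hasDerivAt_primSym τ y _ _ _).mul_const _) ?_ ?_ ?_ ?_
  · intro p y hy
    rw [norm_mul, one_mul]
    gcongr
    refine norm_approxSym_le hτ ?_ _ _ _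
    rw [mem_ball_zero_iff, Real.norm_eq_abs] at hy
    exact hy.le
  · rw [Metric.mem_ball, dist_self]; linarith
  · simp only [primSym_zero, zero_mul]; exact summable_zero
  · rwa [mem_ball_zero_iff, Real.norm_eq_abs]

/-- `v` solves the cubic Schrödinger equation on `[0, τ]` in the interaction picture, and is bounded
by `M` in `H^{γ+2}`. -/
structure IsProfile (γ τ : ℝ) (M : ℝ≥0∞) (v : ℝ → (Fin d → ℤ) → ℂ) : Prop where
  continuousOn : ∀ ξ, ContinuousOn (fun s => v s ξ) (Set.Icc 0 τ)
  hasDerivAt : ∀ s ∈ Set.Ioo 0 τ, ∀ ξ,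
    HasDerivAt (fun s => v s ξ) (Complex.I * tri (phaseSym s) (cstar (v s)) (v s) (v s) ξ) s
  bound : ∀ s ∈ Set.Icc 0 τ, seqNorm (γ + 2) (v s) ≤ M

/-! ### Expansion of the exact solution over one step -/

namespace IsProfile

variable {γ τ : ℝ} {M K₁ K₂ K₃ : ℝ≥0∞} {v : ℝ → (Fin d → ℤ) → ℂ}

lemma mono (h : IsProfile γ τ M v) {s : ℝ} (hs : s ≤ τ) : IsProfile γ s M v :=
  ⟨fun ξ => (h.continuousOn ξ).mono (Set.Icc_subset_Icc_right hs),
    fun r hr => h.hasDerivAt r ⟨hr.1, hr.2.trans_le hs⟩, fun r hr => h.bound r ⟨hr.1, hr.2.trans hs⟩⟩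

lemma bound' (h : IsProfile γ τ M v) {s : ℝ} (hs : s ∈ Set.Icc 0 τ) : seqNorm γ (v s) ≤ M :=
  (seqNorm_mono_exponent (by linarith) _).trans (h.bound s hs)

lemma summable (h : IsProfile γ τ M v) (hγ : (d : ℝ) / 2 < γ) (hM : M ≠ ∞) {s : ℝ}
    (hs : s ∈ Set.Icc 0 τ) : Summable fun ξ => ‖v s ξ‖ :=
  summable_of_seqNorm_lt_top hγ ((h.bound' hs).trans_lt hM.lt_top)

lemma enorm_phaseSym_le (s : ℝ) (ξ η ζ : Fin d → ℤ) : ‖phaseSym s ξ η ζ‖ₑ ≤ 1 := by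
  rw [← ofReal_norm, norm_phaseSym]; simp

lemma seqNorm_I_smul (a : (Fin d → ℤ) → ℂ) : seqNorm γ (Complex.I • a) = seqNorm γ a := by
  rw [seqNorm_smul, ← ofReal_norm]; simp

lemma seqNorm_sub_zero_le (h : IsProfile γ τ M v) (hτ : 0 ≤ τ) (hM : M ≠ ∞)
    (hK : TriBound d γ K₁) (hK₁ : K₁ ≠ ∞) :
    seqNorm γ (v τ - v 0) ≤ K₁ * M ^ 3 * ENNReal.ofReal τ := by
  refine seqNorm_sub_le_of_hasDerivAt (by finiteness) hτ h.continuousOn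
    (a' := fun s => Complex.I • tri (phaseSym s) (cstar (v s)) (v s) (v s)) h.hasDerivAt ?_
  intro s hs
  have hb := h.bound' (Set.Ioo_subset_Icc_self hs)
  rw [seqNorm_I_smul]
  refine (hK _ 1 (enorm_phaseSym_le s) _ _ _).trans ?_
  rw [seqNorm_cstar]
  calc _ ≤ K₁ * 1 * (M * M * M) := by gcongr
    _ = _ := by ring

lemma seqNorm_phaseSym_sub_one_le (hK : TriGrowthBound d γ K₂) {s : ℝ} (hs : 0 ≤ s)
    (a b c : (Fin d → ℤ) → ℂ) :
    seqNorm γ (tri (fun ξ η ζ => phaseSym s ξ η ζ - oneSym ξ η ζ) a b c)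
      ≤ K₂ * (4 * ENNReal.ofReal s)
        * (seqNorm (γ + 2) a * seqNorm (γ + 2) b * seqNorm (γ + 2) c) := by
  refine hK _ _ (fun ξ η ζ => ?_) a b c
  refine (enorm_le_ofReal (norm_phaseSym_sub_one_le hs ξ η ζ)).trans_eq ?_
  rw [wt_two_mul, ENNReal.ofReal_mul (by positivity), ENNReal.ofReal_mul (by positivity)]
  simp

/-- A Taylor estimate without a second time derivative. The derivative of the remainder is O(s)
because the phase is 1 + O(s) with a loss of two derivatives, and v(s) - v(0) = O(s) in H^γ. -/
lemma seqNorm_sub_linear_le (h : IsProfile γ τ M v) (hγ : (d : ℝ) / 2 < γ) (hτ : 0 ≤ τ) (hM : M ≠ ∞)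
    (hK : TriBound d γ K₁) (hK₁ : K₁ ≠ ∞) (hK' : TriGrowthBound d γ K₂) (hK₂ : K₂ ≠ ∞) :
    seqNorm γ (v τ - v 0 - (Complex.I * τ) • cubic (v 0))
      ≤ (4 * K₂ * M ^ 3 + 3 * K₁ ^ 2 * M ^ 5) * ENNReal.ofReal τ ^ 2 := by
  have h0 : (0 : ℝ) ∈ Set.Icc 0 τ := ⟨le_rfl, hτ⟩
  set A : ℝ≥0∞ := (4 * K₂ * M ^ 3 + 3 * K₁ ^ 2 * M ^ 5) with hA
  have := seqNorm_sub_le_of_hasDerivAt (s := γ) (T := τ) (C := A * ENNReal.ofReal τ)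
    (by finiteness) hτ (a := fun s => v s - (Complex.I * s) • cubic (v 0))
    (a' := fun s => Complex.I • (tri (phaseSym s) (cstar (v s)) (v s) (v s) - cubic (v 0)))
    ?_ ?_ ?_
  · calc _ = seqNorm γ (v τ - (Complex.I * τ) • cubic (v 0)
            - (v 0 - (Complex.I * (0 : ℝ)) • cubic (v 0))) := by
          congr 1
          simp only [Complex.ofReal_zero, mul_zero, zero_smul]
          abel
      _ ≤ _ := this
      _ = _ := by ring
  · intro ξ
    refine (h.continuousOn ξ).sub (Continuous.continuousOn ?_)
    simp only [Pi.smul_apply]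
    fun_prop
  · intro s hs ξ
    have h1 := h.hasDerivAt s hs ξ
    have h2 := (((hasDerivAt_id s).ofReal_comp).const_mul Complex.I).mul_const (cubic (v 0) ξ)
    refine (h1.sub h2).congr_deriv ?_
    simp only [Pi.smul_apply, Pi.sub_apply, smul_eq_mul]
    push_cast
    ring
  · intro s hs
    have hs' := Set.Ioo_subset_Icc_self hs
    have hv := h.summable hγ hM hs'
    have hw := h.summable hγ hM h0
    have hvb := h.bound s hs'
    rw [seqNorm_I_smul]
    have e : tri (phaseSym s) (cstar (v s)) (v s) (v s) - cubic (v 0)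
        = tri (fun ξ η ζ => phaseSym s ξ η ζ - oneSym ξ η ζ) (cstar (v s)) (v s) (v s)
          + (tri oneSym (cstar (v s)) (v s) (v s) - tri oneSym (cstar (v 0)) (v 0) (v 0)) := by
      rw [tri_sub_symbol (B := 1) (enorm_phaseSym_le s) (by simp) (by simp)
        (summable_cstar hv) hv hv, cubic]
      abel
    have hδ := (h.mono hs'.2).seqNorm_sub_zero_le hs'.1 hM hK hK₁
    have hδ' : seqNorm γ (cstar (v s) - cstar (v 0)) ≤ K₁ * M ^ 3 * ENNReal.ofReal s := by
      rwa [← cstar_sub, seqNorm_cstar]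
    have hsτ : ENNReal.ofReal s ≤ ENNReal.ofReal τ := ENNReal.ofReal_le_ofReal hs'.2
    rw [e]
    calc _ ≤ K₂ * (4 * ENNReal.ofReal s) * (M * M * M)
          + 3 * K₁ * 1 * M ^ 2 * (K₁ * M ^ 3 * ENNReal.ofReal s) := by
          refine (seqNorm_add_le _ _ _).trans (add_le_add ?_ ?_)
          · refine (seqNorm_phaseSym_sub_one_le hK' hs'.1 _ _ _).trans ?_
            rw [seqNorm_cstar]
            gcongr
          · exact seqNorm_tri_sub_tri_le hK (by simp) (by simp) (summable_cstar hv) hv hv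
              (summable_cstar hw) hw hw (h.bound' hs') (h.bound' hs')
              ((seqNorm_cstar _ _).trans_le (h.bound' h0)) (h.bound' h0) hδ' hδ hδ
      _ = A * ENNReal.ofReal s := by rw [hA]; ring
      _ ≤ _ := by gcongr

end IsProfile

lemma cstar_smul (k : ℂ) (a : (Fin d → ℤ) → ℂ) : cstar (k • a) = conj k • cstar a := by
  ext ξ; simp [cstar]

lemma seqNorm_cubic_le {γ : ℝ} {K M : ℝ≥0∞} (hK : TriBound d γ K) {a : (Fin d → ℤ) → ℂ}
    (ha : seqNorm γ a ≤ M) : seqNorm γ (cubic a) ≤ K * M ^ 3 := by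
  refine (hK _ 1 (by simp) _ _ _).trans ?_
  rw [seqNorm_cstar]
  calc _ ≤ K * 1 * (M * M * M) := by gcongr
    _ = _ := by ring

/-- The linear part, in `δ`, of the cubic nonlinearity with symbol `m`. -/
def triLin (m : (Fin d → ℤ) → (Fin d → ℤ) → (Fin d → ℤ) → ℂ) (w δ : (Fin d → ℤ) → ℂ) :
    (Fin d → ℤ) → ℂ :=
  tri m (cstar δ) w w + tri m (cstar w) δ w + tri m (cstar w) w δ

section TriLin

variable {m : (Fin d → ℤ) → (Fin d → ℤ) → (Fin d → ℤ) → ℂ} {B : ℝ≥0∞} {w : (Fin d → ℤ) → ℂ}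

lemma triLin_sub (hm : ∀ ξ η ζ, ‖m ξ η ζ‖ₑ ≤ B) (hB : B ≠ ∞) {x y : (Fin d → ℤ) → ℂ}
    (hw : Summable fun ξ => ‖w ξ‖) (hx : Summable fun ξ => ‖x ξ‖)
    (hy : Summable fun ξ => ‖y ξ‖) : triLin m w (x - y) = triLin m w x - triLin m w y := by
  rw [triLin, cstar_sub, tri_sub_left hm hB (summable_cstar hx) (summable_cstar hy) hw hw,
    tri_sub_mid hm hB (summable_cstar hw) hx hy hw, tri_sub_right hm hB (summable_cstar hw) hw hx hy,
    triLin, triLin]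
  abel

lemma triLin_sub_symbol {m' : (Fin d → ℤ) → (Fin d → ℤ) → (Fin d → ℤ) → ℂ}
    (hm : ∀ ξ η ζ, ‖m ξ η ζ‖ₑ ≤ B) (hm' : ∀ ξ η ζ, ‖m' ξ η ζ‖ₑ ≤ B) (hB : B ≠ ∞)
    {x : (Fin d → ℤ) → ℂ} (hw : Summable fun ξ => ‖w ξ‖) (hx : Summable fun ξ => ‖x ξ‖) :
    triLin (fun ξ η ζ => m ξ η ζ - m' ξ η ζ) w x = triLin m w x - triLin m' w x := by
  rw [triLin, tri_sub_symbol hm hm' hB (summable_cstar hx) hw hw,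
    tri_sub_symbol hm hm' hB (summable_cstar hw) hx hw,
    tri_sub_symbol hm hm' hB (summable_cstar hw) hw hx, triLin, triLin]
  abel

lemma seqNorm_triLin_le {γ : ℝ} {K : ℝ≥0∞} (hK : TriBound d γ K)
    (hm : ∀ ξ η ζ, ‖m ξ η ζ‖ₑ ≤ B) {R δ : ℝ≥0∞} {x : (Fin d → ℤ) → ℂ} (hw : seqNorm γ w ≤ R)
    (hx : seqNorm γ x ≤ δ) : seqNorm γ (triLin m w x) ≤ 3 * K * B * R ^ 2 * δ := by
  calc _ ≤ K * B * (δ * R * R) + K * B * (R * δ * R) + K * B * (R * R * δ) := by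
        refine (seqNorm_add_le _ _ _).trans (add_le_add ((seqNorm_add_le _ _ _).trans
          (add_le_add ?_ ?_)) ?_) <;>
        · refine (hK m B hm _ _ _).trans ?_
          rw [seqNorm_cstar]
          gcongr
    _ = _ := by ring

lemma seqNorm_triLin_le_of_growth {γ : ℝ} {K : ℝ≥0∞} (hK : TriGrowthBound d γ K)
    (hm : ∀ ξ η ζ, ‖m ξ η ζ‖ₑ ≤ B * (wt 2 ξ * wt 2 η * wt 2 ζ)) {R δ : ℝ≥0∞}
    {x : (Fin d → ℤ) → ℂ} (hw : seqNorm (γ + 2) w ≤ R) (hx : seqNorm (γ + 2) x ≤ δ) :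
    seqNorm γ (triLin m w x) ≤ 3 * K * B * R ^ 2 * δ := by
  calc _ ≤ K * B * (δ * R * R) + K * B * (R * δ * R) + K * B * (R * R * δ) := by
        refine (seqNorm_add_le _ _ _).trans (add_le_add ((seqNorm_add_le _ _ _).trans
          (add_le_add ?_ ?_)) ?_) <;>
        · refine (hK m B hm _ _ _).trans ?_
          rw [seqNorm_cstar]
          gcongr
    _ = _ := by ring

/-- The conjugated slot contributes -is and the two linear slots +is each, all times the same
quintic term; the net coefficient is is. -/
lemma triLin_I_smul_cubic (s : ℝ) (hw : Summable fun ξ => ‖w ξ‖) :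
    triLin oneSym w ((Complex.I * s) • cubic w) = (Complex.I * s) • quintic w := by
  rw [triLin, cstar_smul, tri_smul_left, tri_smul_mid, tri_smul_right, tri_cstar_cubic hw,
    tri_cubic_right hw, ← quintic]
  rw [map_mul, Complex.conj_I, Complex.conj_ofReal]
  module

end TriLin

/-! ### Third-order consistency of one step -/

namespace IsProfile

variable {γ τ : ℝ} {M K₁ K₂ K₃ : ℝ≥0∞} {v : ℝ → (Fin d → ℤ) → ℂ}

/-- The constant of the local error. -/
def localConst (K₁ K₂ K₃ M : ℝ≥0∞) : ℝ≥0∞ :=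
  24 * K₂ * M ^ 3 + 3 * K₁ * M ^ 2 * (4 * K₂ * M ^ 3 + 3 * K₁ ^ 2 * M ^ 5)
    + 12 * K₂ * M ^ 2 * (K₃ * M ^ 3) + 3 * K₁ * M * (K₁ * M ^ 3) ^ 2

/-- With δ = v(s) - v(0) and p its first-order part, the defect has four pieces: the interpolation
error of the symbol, the linear part at δ - p = O(s²), the phase error O(s) acting on p = O(s), and
the terms quadratic in δ. -/
lemma seqNorm_defect_le (h : IsProfile γ τ M v) (hγ : (d : ℝ) / 2 < γ) (hτ : 0 < τ) (hM : M ≠ ∞)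
    (hK : TriBound d γ K₁) (hK₁ : K₁ ≠ ∞) (hK' : TriGrowthBound d γ K₂) (hK₂ : K₂ ≠ ∞)
    (hK'' : TriBound d (γ + 2) K₃) {s : ℝ} (hs : s ∈ Set.Icc 0 τ) :
    seqNorm γ (tri (phaseSym s) (cstar (v s)) (v s) (v s)
        - tri (approxSym τ s) (cstar (v 0)) (v 0) (v 0) - (Complex.I * s) • quintic (v 0))
      ≤ localConst K₁ K₂ K₃ M * ENNReal.ofReal τ ^ 2 := by
  have h0 : (0 : ℝ) ∈ Set.Icc 0 τ := ⟨le_rfl, hτ.le⟩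
  have hv := h.summable hγ hM hs
  have hw := h.summable hγ hM h0
  have hδ := (h.mono hs.2).seqNorm_sub_zero_le hs.1 hM hK hK₁
  have hr := (h.mono hs.2).seqNorm_sub_linear_le hγ hs.1 hM hK hK₁ hK' hK₂
  have hvb := h.bound' hs
  have hwb := h.bound' h0
  have hsτ : ENNReal.ofReal s ≤ ENNReal.ofReal τ := ENNReal.ofReal_le_ofReal hs.2
  set w := v 0
  set δ := v s - w with hδdef
  set p := (Complex.I * s) • cubic w with hp
  have hδs : Summable fun ξ => ‖δ ξ‖ := summable_norm_sub hv hw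
  have hps : Summable fun ξ => ‖p ξ‖ := summable_norm_smul _ (summable_cubic hw)
  have hph := enorm_phaseSym_le (d := d) s
  -- The phase error acting on p loses two derivatives, so p is needed in H^{γ+2}; this is the use
  -- of the algebra property at that level.
  have hPb : seqNorm (γ + 2) p ≤ ENNReal.ofReal s * (K₃ * M ^ 3) := by
    rw [hp, seqNorm_smul]
    have : ‖(Complex.I * s : ℂ)‖ₑ = ENNReal.ofReal s := by
      rw [← ofReal_norm, norm_mul, Complex.norm_I, one_mul, Complex.norm_of_nonneg hs.1]
    rw [this]
    gcongr
    exact seqNorm_cubic_le hK'' (h.bound 0 h0)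
  have hcs : cstar (v s) - cstar w = cstar δ := by rw [hδdef, cstar_sub]
  have hap : ∀ ξ η ζ : Fin d → ℤ, ‖approxSym τ s ξ η ζ‖ₑ ≤ 5 := fun ξ η ζ => by
    have : |s| ≤ 2 * τ := by rw [abs_of_nonneg hs.1]; linarith [hs.2]
    simpa using enorm_le_ofReal (norm_approxSym_le hτ this ξ η ζ)
  have hph5 : ∀ ξ η ζ : Fin d → ℤ, ‖phaseSym s ξ η ζ‖ₑ ≤ 5 := fun ξ η ζ =>
    (hph ξ η ζ).trans (by norm_num)
  have e : tri (phaseSym s) (cstar (v s)) (v s) (v s)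
        - tri (approxSym τ s) (cstar w) w w - (Complex.I * s) • quintic w
      = tri (fun ξ η ζ => phaseSym s ξ η ζ - approxSym τ s ξ η ζ) (cstar w) w w
        + triLin (phaseSym s) w (δ - p)
        + triLin (fun ξ η ζ => phaseSym s ξ η ζ - oneSym ξ η ζ) w p
        + (tri (phaseSym s) (cstar δ) δ (v s) + tri (phaseSym s) (cstar δ) w δ
          + tri (phaseSym s) (cstar w) δ δ) := by
    have ht := tri_taylor hph (by simp) (summable_cstar hv) hv hv (summable_cstar hw) hw hw
    rw [hcs, ← hδdef, ← triLin, sub_eq_iff_eq_add] at ht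
    rw [ht, tri_sub_symbol hph5 hap (by simp) (summable_cstar hw) hw hw,
      triLin_sub hph (by simp) hw hδs hps, triLin_sub_symbol hph (by simp) (by simp) hw hps,
      hp, triLin_I_smul_cubic s hw]
    abel
  rw [e]
  set A := ENNReal.ofReal s
  calc _ ≤ K₂ * (24 * ENNReal.ofReal τ ^ 2) * (M * M * M)
        + 3 * K₁ * 1 * M ^ 2 * ((4 * K₂ * M ^ 3 + 3 * K₁ ^ 2 * M ^ 5) * A ^ 2)
        + 3 * K₂ * (4 * A) * M ^ 2 * (A * (K₃ * M ^ 3))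
        + (K₁ * 1 * ((K₁ * M ^ 3 * A) * (K₁ * M ^ 3 * A) * M)
          + K₁ * 1 * ((K₁ * M ^ 3 * A) * M * (K₁ * M ^ 3 * A))
          + K₁ * 1 * (M * (K₁ * M ^ 3 * A) * (K₁ * M ^ 3 * A))) := by
        refine (seqNorm_add_le _ _ _).trans (add_le_add ((seqNorm_add_le _ _ _).trans
          (add_le_add ((seqNorm_add_le _ _ _).trans (add_le_add ?_ ?_)) ?_)) ?_)
        · refine (hK' _ (24 * ENNReal.ofReal τ ^ 2) (fun ξ η ζ => ?_) _ _ _).trans ?_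
          · refine (enorm_le_ofReal
              (norm_phaseSym_sub_approxSym_le hτ hs.1 hs.2 ξ η ζ)).trans_eq ?_
            rw [wt_two_mul, ENNReal.ofReal_mul (by positivity), ENNReal.ofReal_mul (by positivity),
              ENNReal.ofReal_pow hτ.le]
            simp
          · have := h.bound 0 h0
            rw [seqNorm_cstar]
            gcongr
        · exact seqNorm_triLin_le hK hph hwb hr
        · refine seqNorm_triLin_le_of_growth hK' (fun ξ η ζ => ?_) (h.bound 0 h0) hPb
          refine (enorm_le_ofReal (norm_phaseSym_sub_one_le hs.1 ξ η ζ)).trans_eq ?_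
          have := hs.1
          rw [wt_two_mul, ENNReal.ofReal_mul (by positivity), ENNReal.ofReal_mul (by positivity)]
          simp [A]
        · refine (seqNorm_add_le _ _ _).trans (add_le_add ((seqNorm_add_le _ _ _).trans
            (add_le_add ?_ ?_)) ?_) <;>
          · refine (hK _ 1 hph _ _ _).trans ?_
            rw [seqNorm_cstar]
            gcongr
    _ = 24 * K₂ * M ^ 3 * ENNReal.ofReal τ ^ 2
        + (3 * K₁ * M ^ 2 * (4 * K₂ * M ^ 3 + 3 * K₁ ^ 2 * M ^ 5)
          + 12 * K₂ * M ^ 2 * (K₃ * M ^ 3) + 3 * K₁ * M * (K₁ * M ^ 3) ^ 2) * A ^ 2 := by ring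
    _ ≤ 24 * K₂ * M ^ 3 * ENNReal.ofReal τ ^ 2
        + (3 * K₁ * M ^ 2 * (4 * K₂ * M ^ 3 + 3 * K₁ ^ 2 * M ^ 5)
          + 12 * K₂ * M ^ 2 * (K₃ * M ^ 3) + 3 * K₁ * M * (K₁ * M ^ 3) ^ 2)
          * ENNReal.ofReal τ ^ 2 := by gcongr
    _ = _ := by rw [localConst]; ring

/-- The local error of the integrator is of third order. -/
theorem seqNorm_localError_le (h : IsProfile γ τ M v) (hγ : (d : ℝ) / 2 < γ) (hτ : 0 < τ)
    (hM : M ≠ ∞) (hK : TriBound d γ K₁) (hK₁ : K₁ ≠ ∞) (hK' : TriGrowthBound d γ K₂) (hK₂ : K₂ ≠ ∞)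
    (hK'' : TriBound d (γ + 2) K₃) (hK₃ : K₃ ≠ ∞) :
    seqNorm γ (v τ - stepSeq τ (v 0)) ≤ localConst K₁ K₂ K₃ M * ENNReal.ofReal τ ^ 3 := by
  have h0 : (0 : ℝ) ∈ Set.Icc 0 τ := ⟨le_rfl, hτ.le⟩
  have hw := h.summable hγ hM h0
  -- The numerical step is joined to its initial value by a path in s, with the τ of the interpolant
  -- frozen. At s = 0 it is v(0) and at s = τ it is `stepSeq`.
  have hV (s : ℝ) (hs : s ∈ Set.Icc 0 τ) (ξ : Fin d → ℤ) : HasDerivAt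
      (fun s => v 0 ξ + Complex.I * tri (primSym τ s) (cstar (v 0)) (v 0) (v 0) ξ
        - ((s : ℂ) ^ 2 / 2) * quintic (v 0) ξ)
      (Complex.I * tri (approxSym τ s) (cstar (v 0)) (v 0) (v 0) ξ - s * quintic (v 0) ξ) s := by
    have h1 := hasDerivAt_tri_primSym hτ (s := s) (by rw [abs_of_nonneg hs.1]; linarith [hs.2])
      (summable_cstar hw) hw hw ξ
    have h2 := ((((hasDerivAt_id s).ofReal_comp).pow 2).div_const 2).mul_const (quintic (v 0) ξ)
    refine (((h1.const_mul Complex.I).const_add (v 0 ξ)).sub h2).congr_deriv ?_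
    simp
  have hfin : localConst K₁ K₂ K₃ M * ENNReal.ofReal τ ^ 2 ≠ ∞ := by
    rw [localConst]; finiteness
  have := seqNorm_sub_le_of_hasDerivAt (s := γ) hfin hτ.le
    (a := fun s => v s - (v 0 + Complex.I • tri (primSym τ s) (cstar (v 0)) (v 0) (v 0)
      - ((s : ℂ) ^ 2 / 2) • quintic (v 0)))
    (a' := fun s => Complex.I • (tri (phaseSym s) (cstar (v s)) (v s) (v s)
      - tri (approxSym τ s) (cstar (v 0)) (v 0) (v 0) - (Complex.I * s) • quintic (v 0)))
    ?_ ?_ ?_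
  · calc _ = _ := by
          congr 1
          rw [stepSeq]
          have : tri (primSym τ 0) (cstar (v 0)) (v 0) (v 0) = 0 := by
            ext ξ; simp [tri, primSym_zero]
          simp only [this, Complex.ofReal_zero, smul_zero, add_zero, ne_eq, OfNat.ofNat_ne_zero,
            not_false_eq_true, zero_pow, zero_div, zero_smul, sub_zero, sub_self]
      _ ≤ _ := this
      _ = _ := by ring
  · intro ξ
    exact (h.continuousOn ξ).sub fun s hs => (hV s hs ξ).continuousAt.continuousWithinAt
  · intro s hs ξ
    refine ((h.hasDerivAt s hs ξ).sub (hV s (Set.Ioo_subset_Icc_self hs) ξ)).congr_deriv ?_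
    simp only [Pi.smul_apply, Pi.sub_apply, smul_eq_mul]
    linear_combination ((s : ℂ) * quintic (v 0) ξ) * Complex.I_mul_I
  · intro s hs
    rw [seqNorm_I_smul]
    exact h.seqNorm_defect_le hγ hτ hM hK hK₁ hK' hK₂ hK'' (Set.Ioo_subset_Icc_self hs)

end IsProfile

/-! ### Stability -/

lemma norm_primSym_self_le {τ : ℝ} (hτ : 0 < τ) (ξ η ζ : Fin d → ℤ) :
    ‖primSym τ τ ξ η ζ‖ ≤ 5 * τ := by
  have := norm_sub_le_of_hasDerivAt_Ioo (C := 5) hτ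
    (fun s _ => (hasDerivAt_primSym τ s ξ η ζ).continuousAt.continuousWithinAt)
    (fun s _ => hasDerivAt_primSym τ s ξ η ζ) fun s hs => norm_approxSym_le hτ
      (by rw [abs_of_pos hs.1]; linarith [hs.2]) ξ η ζ
  simpa [primSym_zero] using this

lemma enorm_primSym_self_le {τ : ℝ} (hτ : 0 < τ) (ξ η ζ : Fin d → ℤ) :
    ‖primSym τ τ ξ η ζ‖ₑ ≤ 5 * ENNReal.ofReal τ := by
  refine (enorm_le_ofReal (norm_primSym_self_le hτ ξ η ζ)).trans_eq ?_
  rw [ENNReal.ofReal_mul (by norm_num)]; simp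

/-- The Lipschitz constant of the nonlinear part of the integrator on a ball of radius `R`. -/
def stabConst (K R : ℝ≥0∞) : ℝ≥0∞ :=
  15 * K * R ^ 2 + 3 * K * (R + K * R ^ 3) ^ 2 * (1 + 3 * K * R ^ 2)

lemma seqNorm_cubic_sub_le {γ : ℝ} {K R : ℝ≥0∞} (hK : TriBound d γ K) {a b : (Fin d → ℤ) → ℂ}
    (hsa : Summable fun ξ => ‖a ξ‖) (hsb : Summable fun ξ => ‖b ξ‖)
    (ha : seqNorm γ a ≤ R) (hb : seqNorm γ b ≤ R) :
    seqNorm γ (cubic a - cubic b) ≤ 3 * K * R ^ 2 * seqNorm γ (a - b) := by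
  have h : seqNorm γ (cstar a - cstar b) ≤ seqNorm γ (a - b) := by
    rw [← cstar_sub, seqNorm_cstar]
  have := seqNorm_tri_sub_tri_le (m := oneSym) (B := 1) hK (by simp) (by simp) (summable_cstar hsa)
    hsa hsa (summable_cstar hsb) hsb hsb ha ha ((seqNorm_cstar _ _).trans_le hb) hb h le_rfl le_rfl
  simpa only [mul_one, cubic] using this

lemma seqNorm_quintic_sub_le {γ : ℝ} {K R : ℝ≥0∞} (hK : TriBound d γ K) {a b : (Fin d → ℤ) → ℂ}
    (hsa : Summable fun ξ => ‖a ξ‖) (hsb : Summable fun ξ => ‖b ξ‖)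
    (ha : seqNorm γ a ≤ R) (hb : seqNorm γ b ≤ R) :
    seqNorm γ (quintic a - quintic b)
      ≤ 3 * K * (R + K * R ^ 3) ^ 2 * (1 + 3 * K * R ^ 2) * seqNorm γ (a - b) := by
  -- One common radius bounds the arguments of the outer product, including the cubic one.
  have hR : R ≤ R + K * R ^ 3 := le_self_add
  have hδ : seqNorm γ (a - b) ≤ (1 + 3 * K * R ^ 2) * seqNorm γ (a - b) := by
    rw [add_mul, one_mul]; exact le_self_add
  have h : seqNorm γ (cstar a - cstar b) ≤ (1 + 3 * K * R ^ 2) * seqNorm γ (a - b) := by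
    rw [← cstar_sub, seqNorm_cstar]; exact hδ
  have hc : seqNorm γ (cubic a - cubic b) ≤ (1 + 3 * K * R ^ 2) * seqNorm γ (a - b) := by
    refine (seqNorm_cubic_sub_le hK hsa hsb ha hb).trans ?_
    gcongr
    exact le_add_self
  have := seqNorm_tri_sub_tri_le (m := oneSym) (B := 1) hK (by simp) (by simp) (summable_cstar hsa)
    (summable_cubic hsa) hsa (summable_cstar hsb) (summable_cubic hsb) hsb
    ((seqNorm_cubic_le hK ha).trans le_add_self) (ha.trans hR)
    (((seqNorm_cstar _ _).trans_le hb).trans hR) ((seqNorm_cubic_le hK hb).trans le_add_self)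
    h hc hδ
  refine this.trans_eq ?_
  ring

/-- The integrator is stable in `H^γ`. -/
theorem seqNorm_stepSeq_sub_le {γ τ : ℝ} {K R : ℝ≥0∞} (hK : TriBound d γ K) (hτ : 0 < τ)
    (hτ1 : τ ≤ 1) {a b : (Fin d → ℤ) → ℂ}
    (hsa : Summable fun ξ => ‖a ξ‖) (hsb : Summable fun ξ => ‖b ξ‖)
    (ha : seqNorm γ a ≤ R) (hb : seqNorm γ b ≤ R) :
    seqNorm γ (stepSeq τ a - stepSeq τ b)
      ≤ (1 + stabConst K R * ENNReal.ofReal τ) * seqNorm γ (a - b) := by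
  have h : seqNorm γ (cstar a - cstar b) ≤ seqNorm γ (a - b) := by
    rw [← cstar_sub, seqNorm_cstar]
  have h1 := seqNorm_tri_sub_tri_le hK (enorm_primSym_self_le hτ) (by finiteness)
    (summable_cstar hsa) hsa hsa (summable_cstar hsb) hsb hsb ha ha
    ((seqNorm_cstar _ _).trans_le hb) hb h le_rfl le_rfl
  have h2 := seqNorm_quintic_sub_le hK hsa hsb ha hb
  have e : stepSeq τ a - stepSeq τ b = (a - b)
      + Complex.I • (tri (primSym τ τ) (cstar a) a a - tri (primSym τ τ) (cstar b) b b)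
      + (-((τ : ℂ) ^ 2 / 2)) • (quintic a - quintic b) := by
    rw [stepSeq, stepSeq]; module
  -- Here τ ≤ 1 enters, making the quintic term O(τ) like the cubic one.
  have hc : ‖(-((τ : ℂ) ^ 2 / 2))‖ₑ ≤ ENNReal.ofReal τ := by
    refine enorm_le_ofReal ?_
    rw [norm_neg, norm_div, norm_pow, Complex.norm_of_nonneg hτ.le, Complex.norm_ofNat]
    nlinarith
  rw [e]
  calc _ ≤ seqNorm γ (a - b) + 3 * K * (5 * ENNReal.ofReal τ) * R ^ 2 * seqNorm γ (a - b)
        + ENNReal.ofReal τ *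
          (3 * K * (R + K * R ^ 3) ^ 2 * (1 + 3 * K * R ^ 2) * seqNorm γ (a - b)) := by
        refine (seqNorm_add_le _ _ _).trans (add_le_add ((seqNorm_add_le _ _ _).trans
          (add_le_add le_rfl ?_)) ?_)
        · rwa [IsProfile.seqNorm_I_smul]
        · rw [seqNorm_smul]; gcongr
    _ = _ := by rw [stabConst]; ring

/-! ### The Fourier coefficients of the integrator -/

section Coefficients

open Complex

lemma coeff_propagator (τ : ℝ) (f : L2 d) (ξ : Fin d → ℤ) :
    coeff (propagator τ f) ξ = exp (I * (-(τ * freqSq ξ) : ℝ)) * coeff f ξ := by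
  rw [propagator, coeff_funLaplacian (B := 1)]
  · congr 2; push_cast; ring
  · intro x
    have := norm_exp_I (-(τ * x))
    rw [show I * τ * -(x : ℂ) = I * ((-(τ * x) : ℝ) : ℂ) by push_cast; ring]
    exact this.le

lemma coeff_phiOp (τ : ℝ) (f : L2 d) (ξ : Fin d → ℤ) :
    coeff (phiOp τ f) ξ = phi (2 * I * τ * freqSq ξ) * coeff f ξ := by
  rw [phiOp, coeff_funLaplacian (B := 1)]
  · congr 2; ring
  · intro x
    rw [show -2 * I * τ * -(x : ℂ) = 2 * I * ((τ * x : ℝ) : ℂ) by push_cast; ring]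
    exact norm_phi_le _

lemma coeff_psiOp (τ : ℝ) (f : L2 d) (ξ : Fin d → ℤ) :
    coeff (psiOp τ f) ξ = psi (2 * I * τ * freqSq ξ) * coeff f ξ := by
  rw [psiOp, coeff_funLaplacian (B := 1)]
  · congr 2; ring
  · intro x
    rw [show -2 * I * τ * -(x : ℂ) = 2 * I * ((τ * x : ℝ) : ℂ) by push_cast; ring]
    exact norm_psi_le _

lemma norm_phi_freq_le (τ : ℝ) (ξ : Fin d → ℤ) : ‖phi (2 * I * τ * freqSq ξ)‖ ≤ 1 := by
  rw [show 2 * I * τ * (freqSq ξ : ℂ) = 2 * I * ((τ * freqSq ξ : ℝ) : ℂ) by push_cast; ring]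
  exact norm_phi_le _

lemma norm_psi_freq_le (τ : ℝ) (ξ : Fin d → ℤ) : ‖psi (2 * I * τ * freqSq ξ)‖ ≤ 1 := by
  rw [show 2 * I * τ * (freqSq ξ : ℂ) = 2 * I * ((τ * freqSq ξ : ℝ) : ℂ) by push_cast; ring]
  exact norm_psi_le _

lemma norm_phi_add_psi_freq_le (τ : ℝ) (ξ : Fin d → ℤ) :
    ‖phi (2 * I * τ * freqSq ξ) + psi (2 * I * τ * freqSq ξ)‖ ≤ 2 :=
  (norm_add_le _ _).trans (by linarith [norm_phi_freq_le τ ξ, norm_psi_freq_le τ ξ])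

lemma summable_mul_of_norm_le {B : ℝ} {k a : (Fin d → ℤ) → ℂ} (hk : ∀ ξ, ‖k ξ‖ ≤ B)
    (ha : Summable fun ξ => ‖a ξ‖) : Summable fun ξ => ‖k ξ * a ξ‖ :=
  (ha.mul_left B).of_nonneg_of_le (fun _ => norm_nonneg _) fun ξ => by
    rw [norm_mul]; gcongr; exact hk ξ

/-- The trilinear symbol of the integrator, as the difference of its two nonlinear terms. -/
lemma primSym_self {τ : ℝ} (hτ : τ ≠ 0) (ξ η ζ : Fin d → ℤ) :
    primSym τ τ ξ η ζ
      = τ * (phi (2 * I * τ * freqSq ξ) + psi (2 * I * τ * freqSq ξ))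
        - τ * (psi (2 * I * τ * freqSq ξ) * exp (I * (τ * beta ξ η ζ : ℝ))) := by
  have : (τ : ℂ) ≠ 0 := by exact_mod_cast hτ
  rw [primSym]
  field_simp
  ring

/-- e^{iτβ} is the product of a phase of the output frequency and one of each input frequency:
propagators on the three factors and an inverse propagator outside. -/
lemma tri_primSym_self {τ : ℝ} (hτ : τ ≠ 0) {a : (Fin d → ℤ) → ℂ}
    (ha : Summable fun ξ => ‖a ξ‖) (ξ : Fin d → ℤ) :
    tri (primSym τ τ) (cstar a) a a ξ
      = τ * tri oneSym (fun η => (phi (2 * I * τ * freqSq η) + psi (2 * I * τ * freqSq η))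
          * cstar a η) a a ξ
        - exp (I * (τ * freqSq ξ : ℝ)) * (τ * tri oneSym
          (fun η => exp (I * (-(τ * freqSq η) : ℝ)) * (psi (2 * I * τ * freqSq η) * cstar a η))
          (fun η => exp (I * (-(τ * freqSq η) : ℝ)) * a η)
          (fun η => exp (I * (-(τ * freqSq η) : ℝ)) * a η) ξ) := by
  have hs := summable_cstar ha
  have hE (η : Fin d → ℤ) : ‖exp (I * (-(τ * freqSq η) : ℝ))‖ ≤ 1 := (norm_exp_I _).le
  have hEa := summable_mul_of_norm_le hE ha
  have s1 := summable_tri_norm (m := oneSym) (B := 1) (by simp) (by simp)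
    (summable_mul_of_norm_le (norm_phi_add_psi_freq_le τ) hs) ha ha ξ
  have s2 := summable_tri_norm (m := oneSym) (B := 1) (by simp) (by simp)
    (summable_mul_of_norm_le hE (summable_mul_of_norm_le (norm_psi_freq_le τ) hs)) hEa hEa ξ
  rw [tri, tri, tri, ← tsum_mul_left, ← tsum_mul_left, ← tsum_mul_left,
    ← (s1.of_norm.mul_left _).tsum_sub ((s2.of_norm.mul_left _).mul_left _)]
  refine tsum_congr fun p => ?_
  have hb : exp (I * (τ * beta p.1 p.2 (ξ - p.1 - p.2) : ℝ)) = exp (I * (τ * freqSq ξ : ℝ))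
      * exp (I * (-(τ * freqSq p.1) : ℝ)) * exp (I * (-(τ * freqSq p.2) : ℝ))
      * exp (I * (-(τ * freqSq (ξ - p.1 - p.2)) : ℝ)) := by
    rw [← Complex.exp_add, ← Complex.exp_add, ← Complex.exp_add, beta,
      show p.1 + p.2 + (ξ - p.1 - p.2) = ξ by abel]
    congr 1
    push_cast
    ring
  rw [primSym_self hτ, hb]
  ring

lemma HasFourier.of_coeff_eq {f : L2 d} {a : (Fin d → ℤ) → ℂ} (h : coeff f = a)
    (ha : Summable fun ξ => ‖a ξ‖) : HasFourier f a := by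
  subst h; exact HasFourier.of_summable_coeff ha

/-- The Fourier coefficients of one step of the integrator. -/
theorem coeff_lriStep {τ : ℝ} (hτ : τ ≠ 0) {w : L2 d} (hw : Summable fun ξ => ‖coeff w ξ‖)
    (ξ : Fin d → ℤ) :
    coeff (lriStep τ w) ξ = exp (I * (-(τ * freqSq ξ) : ℝ)) * stepSeq τ (coeff w) ξ := by
  set a := coeff w with ha
  have hs := summable_cstar hw
  have hE (η : Fin d → ℤ) : ‖exp (I * (-(τ * freqSq η) : ℝ))‖ ≤ 1 := (norm_exp_I _).le
  have fw : HasFourier w a := HasFourier.of_summable_coeff hw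
  have hconj : coeff (conjL2 w) = cstar a := fw.conjugate.coeff_toL2
  have f1 : HasFourier (phiOp τ (conjL2 w) + psiOp τ (conjL2 w) : L2 d)
      (fun η => (phi (2 * I * τ * freqSq η) + psi (2 * I * τ * freqSq η)) * cstar a η) := by
    refine HasFourier.of_coeff_eq ?_ (summable_mul_of_norm_le (norm_phi_add_psi_freq_le τ) hs)
    rw [coeff_add]
    ext η
    rw [Pi.add_apply, coeff_phiOp, coeff_psiOp, hconj]
    ring
  have f2 : HasFourier (propagator τ (psiOp τ (conjL2 w)))
      (fun η => exp (I * (-(τ * freqSq η) : ℝ)) * (psi (2 * I * τ * freqSq η) * cstar a η)) := by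
    refine HasFourier.of_coeff_eq ?_
      (summable_mul_of_norm_le hE (summable_mul_of_norm_le (norm_psi_freq_le τ) hs))
    ext η
    rw [coeff_propagator, coeff_psiOp, hconj]
  have f3 : HasFourier (propagator τ w) (fun η => exp (I * (-(τ * freqSq η) : ℝ)) * a η) := by
    refine HasFourier.of_coeff_eq ?_ (summable_mul_of_norm_le hE hw)
    ext η
    rw [coeff_propagator]
  have p1 := ((f1.mul_mul fw fw).congr (g := fun x =>
    (phiOp τ (conjL2 w) + psiOp τ (conjL2 w) : L2 d) x * w x ^ 2)
    (Filter.Eventually.of_forall fun x => by ring)).coeff_toL2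
  have p2 := ((f2.mul_mul f3 f3).congr (g := fun x =>
    propagator τ (psiOp τ (conjL2 w)) x * propagator τ w x ^ 2)
    (Filter.Eventually.of_forall fun x => by ring)).coeff_toL2
  have p3 := ((fw.conjugate.mul_mul (fw.conjugate.mul_mul fw fw) fw).congr
    (g := fun x => (‖w x‖ : ℂ) ^ 4 * w x) (Filter.Eventually.of_forall fun x => by
      have : (‖w x‖ : ℂ) ^ 2 = conj (w x) * w x := by rw [Complex.conj_mul']
      beta_reduce
      rw [show (‖w x‖ : ℂ) ^ 4 = ((‖w x‖ : ℂ) ^ 2) ^ 2 by ring, this]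
      ring)).coeff_toL2
  -- The ψ-product in the scheme has no outer propagator, since it cancels the inverse one coming
  -- from e^{iτβ}.
  have hEE : exp (I * (-(τ * freqSq ξ) : ℝ)) * exp (I * (τ * freqSq ξ : ℝ)) = 1 := by
    rw [← Complex.exp_add]
    push_cast
    ring_nf
    simp
  rw [lriStep, coeff_sub, coeff_sub, coeff_add, coeff_smul, coeff_smul, coeff_smul]
  simp only [Pi.sub_apply, Pi.add_apply, Pi.smul_apply, smul_eq_mul, coeff_propagator]
  rw [p1, p2, p3, stepSeq]
  simp only [Pi.sub_apply, Pi.add_apply, Pi.smul_apply, smul_eq_mul]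
  rw [tri_primSym_self hτ hw, ← ha, quintic, cubic]
  linear_combination (-(I * (τ * tri oneSym
          (fun η => exp (I * (-(τ * freqSq η) : ℝ)) * (psi (2 * I * τ * freqSq η) * cstar a η))
          (fun η => exp (I * (-(τ * freqSq η) : ℝ)) * a η)
          (fun η => exp (I * (-(τ * freqSq η) : ℝ)) * a η) ξ))) * (-hEE)

end Coefficients

/-! ### Regularity of the solution -/

lemma sobolevNorm_eq (s : ℝ) (f : L2 d) :
    sobolevNorm s f = ENNReal.ofReal ((2 * Real.pi) ^ ((d : ℝ) / 2)) * seqNorm s (coeff f) := by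
  rw [sobolevNorm, seqNorm, l2]
  congr 3
  ext ξ
  have := one_add_freqSq_pos ξ
  rw [mul_pow, sq (wt s ξ), ← wt_add_exponent, wt, ENNReal.ofReal_mul (by positivity),
    ENNReal.ofReal_pow (norm_nonneg _), ofReal_norm]
  congr 3
  ring

/-- The factor between `sobolevNorm` and `seqNorm`. -/
def normFactor (d : ℕ) : ℝ := (2 * Real.pi) ^ ((d : ℝ) / 2)

lemma normFactor_pos : 0 < normFactor d := Real.rpow_pos_of_pos Real.two_pi_pos _

/-- A bound in `L^∞(0, T; H^s)` of a function in `C([0, T]; L²)` holds at all times. -/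
lemma seqNorm_coeff_le_of_supSobolevNorm_le {s T : ℝ} (hT : 0 < T) {u : ℝ → L2 d}
    (hu : ContinuousOn u (Set.Icc 0 T)) {M : ℝ≥0∞} (hM : supSobolevNorm s T u ≤ M) {t : ℝ}
    (ht : t ∈ Set.Icc 0 T) :
    seqNorm s (coeff (u t)) ≤ (ENNReal.ofReal (normFactor d))⁻¹ * M := by
  have hae : ∀ᵐ t, t ∈ Set.Ioo 0 T →
      seqNorm s (coeff (u t)) ≤ (ENNReal.ofReal (normFactor d))⁻¹ * M := by
    rw [← ae_restrict_iff' measurableSet_Ioo]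
    filter_upwards [ENNReal.ae_le_essSup fun t => sobolevNorm s (u t)] with t ht
    rw [← ENNReal.div_eq_inv_mul, ENNReal.le_div_iff_mul_le
      (Or.inl (ENNReal.ofReal_pos.2 normFactor_pos).ne') (Or.inl ENNReal.ofReal_ne_top),
      mul_comm (seqNorm _ _)]
    exact (sobolevNorm_eq s (u t)).symm.trans_le (ht.trans hM)
  -- The bound holds on a dense set of times. Finite partial sums of the norm are continuous in
  -- time, so they inherit it everywhere, and the supremum over finite sets follows.
  have hcl := (Measure.dense_of_ae hae).open_subset_closure_inter (isOpen_Ioo (a := 0) (b := T))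
  have hcl' := closure_minimal hcl isClosed_closure
  rw [closure_Ioo hT.ne] at hcl'
  refine seqNorm_le_of_forall_finset fun S => ?_
  have hcont : ContinuousOn (fun t => ∑ ξ ∈ S, (wt s ξ * ‖coeff (u t) ξ‖ₑ) ^ 2) (Set.Icc 0 T) := by
    refine continuousOn_finsetSum S fun ξ _ => ?_
    refine (ENNReal.continuous_pow 2).comp_continuousOn
      ((ENNReal.continuous_const_mul (wt_ne_top s ξ)).comp_continuousOn
        (continuous_enorm.comp_continuousOn ((continuous_coeff ξ).comp_continuousOn hu)))
  refine ContinuousWithinAt.closure_le (hcl' ht)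
    ((hcont t ht).mono fun r hr => Set.Ioo_subset_Icc_self hr.1) continuousWithinAt_const ?_
  intro r hr
  exact (sum_sq_le_seqNorm_sq s _ S).trans (pow_le_pow_left' (hr.2 hr.1) 2)

-- Differentiating e^{is|ξ|²}û cancels the Laplacian term. Conjugation reverses the phase of the
-- first factor, so the phases of the three factors and of the output combine to `phaseSym`.
open Complex in
lemma isProfile_of_isSolution {γ T : ℝ} (hγ : (d : ℝ) / 2 < γ) {u₀ : L2 d} {u : ℝ → L2 d}
    (hu : IsSolution T u₀ u) {M : ℝ≥0∞} (hM : M ≠ ∞)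
    (hb : ∀ t ∈ Set.Icc 0 T, seqNorm (γ + 2) (coeff (u t)) ≤ M) {t τ : ℝ} (ht : 0 ≤ t)
    (htτ : t + τ ≤ T) :
    IsProfile γ τ M fun s ξ => exp (I * (s * freqSq ξ : ℝ)) * coeff (u (t + s)) ξ := by
  have hmem {s : ℝ} (hs : s ∈ Set.Icc 0 τ) : t + s ∈ Set.Icc 0 T :=
    ⟨by linarith [hs.1], by linarith [hs.2]⟩
  refine ⟨fun ξ => ?_, fun s hs ξ => ?_, fun s hs => ?_⟩
  · refine ContinuousOn.mul (Continuous.continuousOn (by fun_prop)) ?_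
    exact (continuous_coeff ξ).comp_continuousOn
      (hu.continuousOn.comp (by fun_prop) fun s hs => hmem hs)
  · have hts : t + s ∈ Set.Ioo 0 T := ⟨by linarith [hs.1], by linarith [hs.2]⟩
    obtain ⟨v, hv, heq⟩ := hu.equation (t + s) hts ξ
    have hsum : Summable fun ξ => ‖coeff (u (t + s)) ξ‖ := by
      refine summable_of_seqNorm_lt_top hγ
        (((seqNorm_mono_exponent (t := γ + 2) (by linarith) _).trans (hb _ ?_)).trans_lt hM.lt_top)
      exact Set.Ioo_subset_Icc_self hts
    have hF := HasFourier.of_summable_coeff hsum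
    have hcub := (((hF.conjugate.mul_mul hF hF).congr
      (g := fun x => (‖u (t + s) x‖ : ℂ) ^ 2 * u (t + s) x)
      (Filter.Eventually.of_forall fun x => by
        beta_reduce
        rw [← Complex.conj_mul'])).coeff_eq ξ)
    rw [hcub] at heq
    have h1 : HasDerivAt (fun s : ℝ => coeff (u (t + s)) ξ) v s := by
      exact hv.comp_const_add t s
    have h2 : HasDerivAt (fun s : ℝ => exp (I * (s * freqSq ξ : ℝ)))
        (exp (I * (s * freqSq ξ : ℝ)) * (I * freqSq ξ)) s := by
      have : HasDerivAt (fun s : ℝ => I * (s * freqSq ξ : ℝ)) (I * freqSq ξ) s := by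
        have := (((hasDerivAt_id s).mul_const (freqSq ξ)).ofReal_comp).const_mul I
        simpa using this
      exact this.cexp
    refine (h2.mul h1).congr_deriv ?_
    set a := coeff (u (t + s)) with ha
    have htri : tri (phaseSym s)
        (cstar fun ξ => exp (I * (s * freqSq ξ : ℝ)) * a ξ)
        (fun ξ => exp (I * (s * freqSq ξ : ℝ)) * a ξ)
        (fun ξ => exp (I * (s * freqSq ξ : ℝ)) * a ξ) ξ
        = exp (I * (s * freqSq ξ : ℝ)) * tri oneSym (cstar a) a a ξ := by
      rw [tri, tri, ← tsum_mul_left]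
      refine tsum_congr fun p => ?_
      have hc : cstar (fun ξ => exp (I * (s * freqSq ξ : ℝ)) * a ξ) p.1
          = exp (I * (-(s * freqSq p.1) : ℝ)) * cstar a p.1 := by
        rw [cstar, map_mul, ← exp_conj, map_mul, conj_I, conj_ofReal, freqSq_neg, cstar]
        congr 2
        push_cast
        ring
      have hp : exp (I * (s * freqSq ξ : ℝ)) = phaseSym s p.1 p.2 (ξ - p.1 - p.2)
          * exp (I * (-(s * freqSq p.1) : ℝ)) * exp (I * (s * freqSq p.2 : ℝ))
          * exp (I * (s * freqSq (ξ - p.1 - p.2) : ℝ)) := by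
        rw [phaseSym, ← Complex.exp_add, ← Complex.exp_add, ← Complex.exp_add, alpha, beta,
          show p.1 + p.2 + (ξ - p.1 - p.2) = ξ by abel]
        congr 1
        push_cast
        ring
      rw [hc, hp]
      ring
    rw [htri]
    have hv' : v = -I * freqSq ξ * a ξ + I * tri oneSym (cstar a) a a ξ := by
      linear_combination (-I) * heq + v * I_mul_I
    rw [hv']
    ring
  · refine le_trans (le_of_eq (seqNorm_congr fun ξ => ?_)) (hb _ (hmem hs))
    rw [enorm_mul, ← ofReal_norm, norm_exp_I]
    simp

/-! ### The global error -/

open Complex in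
/-- One step of the error recursion. -/
lemma seqNorm_error_succ_le {γ T : ℝ} (hγ : (d : ℝ) / 2 < γ) {u₀ : L2 d} {u : ℝ → L2 d}
    (hu : IsSolution T u₀ u) {M K₁ K₂ K₃ : ℝ≥0∞} (hM : M ≠ ∞)
    (hb : ∀ t ∈ Set.Icc 0 T, seqNorm (γ + 2) (coeff (u t)) ≤ M)
    (hK : TriBound d γ K₁) (hK₁ : K₁ ≠ ∞) (hK' : TriGrowthBound d γ K₂) (hK₂ : K₂ ≠ ∞)
    (hK'' : TriBound d (γ + 2) K₃) (hK₃ : K₃ ≠ ∞) {t τ : ℝ} (ht : 0 ≤ t) (hτ : 0 < τ)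
    (hτ1 : τ ≤ 1) (htτ : t + τ ≤ T) {w : L2 d} (hw : seqNorm γ (coeff (u t) - coeff w) ≤ 1) :
    seqNorm γ (coeff (u (t + τ)) - coeff (lriStep τ w))
      ≤ IsProfile.localConst K₁ K₂ K₃ M * ENNReal.ofReal τ ^ 3
        + (1 + stabConst K₁ (M + 1) * ENNReal.ofReal τ) * seqNorm γ (coeff (u t) - coeff w) := by
  have hp := isProfile_of_isSolution hγ hu hM hb ht htτ
  have hloc := hp.seqNorm_localError_le hγ hτ hM hK hK₁ hK' hK₂ hK'' hK₃
  have hut : seqNorm γ (coeff (u t)) ≤ M :=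
    (seqNorm_mono_exponent (by linarith) _).trans (hb t ⟨ht, by linarith⟩)
  have hwR : seqNorm γ (coeff w) ≤ M + 1 := by
    rw [show coeff (w : Torus d → ℂ) = coeff (u t) - (coeff (u t) - coeff w) by abel]
    exact (seqNorm_sub_le _ _ _).trans (add_le_add hut hw)
  have hsu := summable_of_seqNorm_lt_top hγ (hut.trans_lt hM.lt_top)
  have hsw := summable_of_seqNorm_lt_top hγ (hwR.trans_lt (by finiteness))
  have hstab := seqNorm_stepSeq_sub_le hK hτ hτ1 hsu hsw (hut.trans le_self_add) hwR
  have h0 : (fun ξ => exp (I * ((0 : ℝ) * freqSq ξ : ℝ)) * coeff (u (t + 0)) ξ) = coeff (u t) := by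
    ext ξ; simp
  simp only [h0] at hloc
  -- Multiplication by e^{iτ|ξ|²} preserves the norm and turns the error into local error plus
  -- propagated error.
  calc _ = seqNorm γ (((fun ξ => exp (I * (τ * freqSq ξ : ℝ)) * coeff (u (t + τ)) ξ)
          - stepSeq τ (coeff (u t))) + (stepSeq τ (coeff (u t)) - stepSeq τ (coeff w))) := by
        refine seqNorm_congr fun ξ => ?_
        rw [Pi.sub_apply, coeff_lriStep hτ.ne' hsw]
        have hEE : exp (I * (-(τ * freqSq ξ) : ℝ)) * exp (I * (τ * freqSq ξ : ℝ)) = 1 := by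
          rw [← Complex.exp_add]
          push_cast
          ring_nf
          simp
        have hE : ‖exp (I * (-(τ * freqSq ξ) : ℝ))‖ₑ = 1 := by
          rw [← ofReal_norm, norm_exp_I]; simp
        rw [← one_mul ‖(_ + _ : (Fin d → ℤ) → ℂ) ξ‖ₑ, ← hE, ← enorm_mul]
        congr 1
        simp only [Pi.add_apply, Pi.sub_apply]
        linear_combination (-coeff (u (t + τ)) ξ) * hEE
    _ ≤ _ := (seqNorm_add_le _ _ _).trans (add_le_add hloc hstab)

/-- The error after `n` steps. -/
lemma seqNorm_error_le {γ T : ℝ} (hγ : (d : ℝ) / 2 < γ) {u₀ : L2 d} {u : ℝ → L2 d}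
    (hu : IsSolution T u₀ u) {M K₁ K₂ K₃ : ℝ≥0∞} (hM : M ≠ ∞)
    (hb : ∀ t ∈ Set.Icc 0 T, seqNorm (γ + 2) (coeff (u t)) ≤ M)
    (hK : TriBound d γ K₁) (hK₁ : K₁ ≠ ∞) (hK' : TriGrowthBound d γ K₂) (hK₂ : K₂ ≠ ∞)
    (hK'' : TriBound d (γ + 2) K₃) (hK₃ : K₃ ≠ ∞) {A L : ℝ}
    (hA0 : 0 ≤ A) (hL0 : 0 ≤ L) (hA : IsProfile.localConst K₁ K₂ K₃ M = ENNReal.ofReal A)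
    (hL : stabConst K₁ (M + 1) = ENNReal.ofReal L) {τ : ℝ} (hτ : 0 < τ) (hτ1 : τ ≤ 1)
    (hsmall : A * T * Real.exp (L * T) * τ ^ 2 ≤ 1) (n : ℕ) (hn : n * τ ≤ T) :
    seqNorm γ (coeff (u (n * τ)) - coeff (lri τ u₀ n))
      ≤ ENNReal.ofReal (A * T * Real.exp (L * T) * τ ^ 2) := by
  have hgrow (n : ℕ) (hn : n * τ ≤ T) :
      A * τ ^ 3 * n * (1 + L * τ) ^ n ≤ A * T * Real.exp (L * T) * τ ^ 2 := by
    have h1 : (1 + L * τ) ^ n ≤ Real.exp (L * T) := by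
      calc (1 + L * τ) ^ n ≤ Real.exp (L * τ) ^ n := by
            gcongr
            linarith [Real.add_one_le_exp (L * τ)]
        _ = Real.exp (L * (n * τ)) := by rw [← Real.exp_nat_mul]; ring_nf
        _ ≤ _ := by gcongr
    calc _ = A * τ ^ 2 * (n * τ) * (1 + L * τ) ^ n := by ring
      _ ≤ A * τ ^ 2 * T * Real.exp (L * T) := by
          have : 0 ≤ T := le_trans (by positivity) hn
          gcongr
      _ = _ := by ring
  -- The induction needs this bound with explicit n, a closed form that dominates the recursion
  -- e_{n+1} ≤ Aτ³ + (1 + Lτ)e_n.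
  suffices h : seqNorm γ (coeff (u (n * τ)) - coeff (lri τ u₀ n))
      ≤ ENNReal.ofReal (A * τ ^ 3 * n * (1 + L * τ) ^ n) from
    h.trans (ENNReal.ofReal_le_ofReal (hgrow n hn))
  induction n with
  | zero => simp [lri, hu.initial, seqNorm_zero]
  | succ n ih =>
    push_cast at hn
    have hn' : n * τ ≤ T := by linarith
    have ih := ih hn'
    -- Bootstrap: the bound at step n keeps the numerical solution in the ball of radius M + 1,
    -- where the Lipschitz constant is valid for the next step.
    have hone : seqNorm γ (coeff (u (n * τ)) - coeff (lri τ u₀ n)) ≤ 1 := by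
      refine ih.trans ?_
      rw [ENNReal.ofReal_le_one]
      exact (hgrow n hn').trans hsmall
    have h := seqNorm_error_succ_le hγ hu hM hb hK hK₁ hK' hK₂ hK'' hK₃ (by positivity) hτ hτ1
      (by linarith) hone
    rw [show ((n + 1 : ℕ) : ℝ) * τ = n * τ + τ by push_cast; ring, lri]
    refine h.trans ?_
    rw [hA, hL]
    calc _ ≤ ENNReal.ofReal A * ENNReal.ofReal τ ^ 3 + (1 + ENNReal.ofReal L * ENNReal.ofReal τ)
          * ENNReal.ofReal (A * τ ^ 3 * n * (1 + L * τ) ^ n) := by gcongr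
      _ = ENNReal.ofReal (A * τ ^ 3 + (1 + L * τ) * (A * τ ^ 3 * n * (1 + L * τ) ^ n)) := by
          rw [ENNReal.ofReal_add (by positivity) (by positivity), ENNReal.ofReal_mul hA0,
            ENNReal.ofReal_pow hτ.le, ENNReal.ofReal_mul (p := 1 + L * τ) (by positivity),
            ENNReal.ofReal_add zero_le_one (by positivity), ENNReal.ofReal_mul hL0,
            ENNReal.ofReal_one]
      _ ≤ _ := by
          refine ENNReal.ofReal_le_ofReal ?_
          have h1 : 1 ≤ (1 + L * τ) ^ (n + 1) :=
            one_le_pow₀ (by linarith [mul_nonneg hL0 hτ.le])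
          have h2 : A * τ ^ 3 * 1 ≤ A * τ ^ 3 * (1 + L * τ) ^ (n + 1) := by gcongr
          push_cast
          calc _ = A * τ ^ 3 * 1 + A * τ ^ 3 * n * (1 + L * τ) ^ (n + 1) := by ring
            _ ≤ A * τ ^ 3 * (1 + L * τ) ^ (n + 1) + A * τ ^ 3 * n * (1 + L * τ) ^ (n + 1) := by
                gcongr
            _ = _ := by ring

end CubicNLS

end

theorem theorem1 (d : ℕ) (hd : 1 ≤ d) (γ : ℝ) (hγ : (d : ℝ) / 2 < γ) (T : ℝ) (hT : 0 < T)
    (M : ℝ≥0) :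
    ∃ τ₀ : ℝ, 0 < τ₀ ∧ ∃ C : ℝ, 0 < C ∧
      ∀ (u₀ : CubicNLS.L2 d) (u : ℝ → CubicNLS.L2 d),
        u₀ ∈ CubicNLS.sobolev d (γ + 2) →
        CubicNLS.IsSolution T u₀ u →
        CubicNLS.supSobolevNorm (γ + 2) T u ≤ (M : ℝ≥0∞) →
        ∀ τ : ℝ, 0 < τ → τ ≤ τ₀ → ∀ n : ℕ, (n : ℝ) * τ ≤ T →
          CubicNLS.sobolevNorm γ (u (n * τ) - CubicNLS.lri τ u₀ n) ≤ ENNReal.ofReal (C * τ ^ 2) := by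
  open CubicNLS in
  obtain ⟨K₁, hK₁⟩ := exists_seqNorm_tri_le hγ
  obtain ⟨K₂, hK₂⟩ := exists_seqNorm_tri_le_of_growth hγ
  obtain ⟨K₃, hK₃⟩ := exists_seqNorm_tri_le (d := d) (γ := γ + 2) (by linarith)
  have hc := normFactor_pos (d := d)
  set M' : ℝ≥0∞ := (ENNReal.ofReal (normFactor d))⁻¹ * M with hM'
  have hM'fin : M' ≠ ∞ := ENNReal.mul_ne_top
    (ENNReal.inv_ne_top.2 (ENNReal.ofReal_pos.2 hc).ne') ENNReal.coe_ne_top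
  have hAfin : IsProfile.localConst K₁ K₂ K₃ M' ≠ ∞ := by
    rw [IsProfile.localConst]; finiteness
  have hLfin : stabConst K₁ (M' + 1) ≠ ∞ := by
    rw [stabConst]; finiteness
  set A := (IsProfile.localConst K₁ K₂ K₃ M').toReal
  set L := (stabConst K₁ (M' + 1)).toReal
  have hA0 : 0 ≤ A := ENNReal.toReal_nonneg
  have hL0 : 0 ≤ L := ENNReal.toReal_nonneg
  set X := A * T * Real.exp (L * T)
  have hX : 0 ≤ X := by positivity
  -- This τ₀ forces τ ≤ 1 and Xτ ≤ 1, hence Xτ² ≤ 1 as the bootstrap requires. The + 1 in C only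
  -- ensures C > 0.
  refine ⟨1 / (X + 1), by positivity, normFactor d * X + 1, by positivity, ?_⟩
  intro u₀ u _ hu hsup τ hτ hτ₀ n hn
  have hτ1 : τ ≤ 1 := hτ₀.trans ((div_le_one (by positivity)).2 (by linarith))
  have hXτ : X * τ ≤ 1 := by
    rw [le_div_iff₀ (by positivity)] at hτ₀
    linarith
  have hsmall : X * τ ^ 2 ≤ 1 := by nlinarith
  have h := seqNorm_error_le hγ hu hM'fin
    (fun t ht => seqNorm_coeff_le_of_supSobolevNorm_le hT hu.continuousOn hsup ht)
    hK₁ ENNReal.coe_ne_top hK₂ ENNReal.coe_ne_top hK₃ ENNReal.coe_ne_top hA0 hL0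
    (ENNReal.ofReal_toReal hAfin).symm (ENNReal.ofReal_toReal hLfin).symm hτ hτ1 hsmall n hn
  rw [sobolevNorm_eq, coeff_sub]
  calc _ ≤ ENNReal.ofReal (normFactor d) * ENNReal.ofReal (X * τ ^ 2) := by gcongr; exact le_rfl
    _ = ENNReal.ofReal (normFactor d * (X * τ ^ 2)) := (ENNReal.ofReal_mul hc.le).symm
    _ ≤ _ := ENNReal.ofReal_le_ofReal (by nlinarith [sq_nonneg τ])
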